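/- **Setting.** Let $g$ be an element of order $r\ge 2$ of a finite group, let $m\in\mathbb Z_{>0}$ with $r<2^m$, let $\ell=m-\Delta$ for some $\Delta\in[0,m)\cap\mathbb Z$, let $c\ge 1$ be real, and let $B\in[1,B_{\max})\cap\mathbb Z$, where $B_{\max}=(2^{m+\ell}/r-1)/2$. Write $\log$ for the base-two logarithm. *Quantum part.* Measure the first register of $$\frac1{2^{m+\ell}}\sum_{a,\,j=0}^{2^{m+\ell}-1}\exp\!\Big[\frac{2\pi i}{2^{m+\ell}}\,aj\Big]\,|j,g^a\rangle ,$$ and let $j$ be the frequency observed. *Lattice-based post-processing.* The candidate frequencies are $k=j,\,j\pm1,\dots,j\pm B$, reduced modulo $2^{m+\ell}$. For each of them, let $\mathcal L(k)$ be the lattice spanned by $(k,\tfrac12)$ and $(2^{m+\ell},0)$. Compute a reduced basis $(s_1,s_2)$ of $\mathcal L(k)$ with Lagrange's algorithm, and let $\lambda_2^{\perp}$ be the norm of the component of $s_2$ orthogonal to $s_1$. If $\lambda_2^\perp\ge 2^{m-1/2}$, take only the vector $s_1$; otherwise enumerate all vectors $w\in\mathcal L(k)$ with $|w|<2^{m-1/2}$.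 Each vector $w=(w_1,w_2)$ obtained gives a candidate $t=2|w_2|$. From each candidate $t\in[1,2^m)$, try to compute a positive multiple of $r$ by one of the following two algorithms, in which $q$ runs over the primes $q\le cm$ and $e_q=\lfloor\log_q(cm)\rfloor$. Candidates $t\notin[1,2^m)$ are discarded. * *Sequential algorithm.* Put $x=g^t$. If $x=1$, return $t$. Otherwise, for the primes $q$ in increasing order, push $(x,q,e_q)$ onto a stack and replace $x$ by $x^{q^{e_q}}$, stopping as soon as $x=1$. If $x\ne1$ at the end, fail. Otherwise put $d=1$, and pop the triples $(x,q,e)$ off the stack in turn: replace $x$ by $x^d$ and then, at most $e$ times and as long as $x\neq1$, replace $x$ by $x^q$ and $d$ by $dq$. Return $d\cdot t$. * *Tree algorithm.* By binary splitting of the set of primes, compute for every $q$ the element $x_q=g^{t\prod_{q'\ne q}q'^{\,e_{q'}}}$, where the product is over the other primes $q'\le cm$. Start from $d=1$. For each $q$, as long as $x_q\ne1$, replace $x_q$ by $x_q^q$ and $d$ by $dq$; fail if more than $e_q$ such steps are needed for some $q$. Return $d\cdot t$. The output is the minimum of all values that are returned. **Claim.** For every observed $j$ there are at most $2B+1$ candidate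 frequencies, and for each of them at most $6\sqrt3\cdot2^{\Delta}$ vectors are enumerated, all of them in the corresponding lattice. With either of the two algorithms, a single run of the quantum part followed by this post-processing outputs $r$ with probability at least $$\left(1-\frac1{\pi^2}\left(\frac2B+\frac1{B^2}+\frac1{3B^3}\right)-\frac{\pi^2r(2B+1)}{2^{m+\ell}}\right)\left(1-\frac1{c\log (cm)}\right).$$ -/

import Mathlib

namespace OrderFinding

/-! ### The quantum part -/

section Quantum

variable {G : Type*} [Group G] [Fintype G] [DecidableEq G]

/-- The state `2^{-n} ∑_{a, j = 0}^{2^n - 1} exp (2 π i a j / 2^n) |j, g^a⟩` of a frequency register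
of `n` qubits and a register that holds group elements. -/
noncomputable def quantumState (g : G) (n : ℕ) : EuclideanSpace ℂ (Fin (2 ^ n) × G) :=
  (1 / (2 : ℂ) ^ n) • ∑ a : Fin (2 ^ n), ∑ j : Fin (2 ^ n),
    Complex.exp (2 * (Real.pi : ℂ) * Complex.I / (2 : ℂ) ^ n * ((a : ℕ) : ℂ) * ((j : ℕ) : ℂ)) •
      EuclideanSpace.single (j, g ^ (a : ℕ)) (1 : ℂ)

/-- Born rule: the probability of observing the frequency `j` when the first register of the state
is measured. -/
noncomputable def frequencyProb (g : G) (n : ℕ) (j : Fin (2 ^ n)) : ℝ :=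
  ∑ h : G, ‖quantumState g n (j, h)‖ ^ 2

end Quantum

/-! ### Lattice-based solving of one frequency

For an integer `k`, the lattice `𝓛(k)` is spanned by `(k, 1/2)` and `(2^n, 0)`. As the second
component of every vector is a half-integer, the algorithms store the vector `(a, b / 2)` as the
pair of integers `(a, b)`. -/

/-- The lattice `𝓛(k)` in the Euclidean plane. -/
noncomputable def lattice (n : ℕ) (k : ℤ) : Submodule ℤ (EuclideanSpace ℝ (Fin 2)) :=
  Submodule.span ℤ {!₂[(k : ℝ), (1 / 2 : ℝ)], !₂[(2 : ℝ) ^ n, (0 : ℝ)]}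

/-- The vector of the plane that is stored as the pair `w`. -/
noncomputable def toVec (w : ℤ × ℤ) : EuclideanSpace ℝ (Fin 2) :=
  !₂[(w.1 : ℝ), (w.2 : ℝ) / 2]

/-- Four times the Euclidean inner product of the stored vectors. -/
def dot (u v : ℤ × ℤ) : ℤ := 4 * u.1 * v.1 + u.2 * v.2

/-- One size-reduction step: subtract from `v` the multiple of `u` nearest to the projection of
`v` onto `u`. -/
def sizeReduce (u v : ℤ × ℤ) : ℤ × ℤ :=
  v - round ((dot u v : ℚ) / (dot u u : ℚ)) • u

/-- Lagrange's algorithm for the reduction of a basis of a two-dimensional lattice. -/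
def lagrange (u v : ℤ × ℤ) : (ℤ × ℤ) × (ℤ × ℤ) :=
  if dot (sizeReduce u v) (sizeReduce u v) < dot u u then
    lagrange (sizeReduce u v) u
  else (u, sizeReduce u v)
termination_by (dot u u).toNat
decreasing_by
  have h0 : 0 ≤ dot (sizeReduce u v) (sizeReduce u v) := by
    unfold dot
    nlinarith [mul_self_nonneg (sizeReduce u v).1, mul_self_nonneg (sizeReduce u v).2]
  omega

/-- The Lagrange-reduced basis `(s₁, s₂)` of `𝓛(k)`. -/
def reducedBasis (n : ℕ) (k : ℤ) : (ℤ × ℤ) × (ℤ × ℤ) := lagrange (k, 1) (2 ^ n, 0)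

/-- `dot s₁ s₁ * dot s₂ s₂ - (dot s₁ s₂) ^ 2`, which is `4 * dot s₁ s₁` times the square of the
norm `λ₂⊥` of the component of `s₂` that is orthogonal to `s₁`. -/
def gram (s₁ s₂ : ℤ × ℤ) : ℤ := dot s₁ s₁ * dot s₂ s₂ - dot s₁ s₂ ^ 2

/-- Enumeration of the vectors `m₁ s₁ + m₂ s₂` of norm less than `2^{m - 1/2}`, that is with
`dot w w < 2^{2m + 1}`. Multiplied by `dot s₁ s₁`, this inequality reads
`(dot s₁ s₁ * m₁ + dot s₁ s₂ * m₂)² < dot s₁ s₁ * 2^{2m + 1} - gram s₁ s₂ * m₂²`.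
The outer loop runs over all `m₂` for which the right-hand side is positive, and the inner one over
all `m₁` that satisfy it. -/
noncomputable def shortVectors (m : ℕ) (s₁ s₂ : ℤ × ℤ) : Finset (ℤ × ℤ) :=
  let A := dot s₁ s₁
  let M := Int.sqrt ((A * 2 ^ (2 * m + 1) - 1) / gram s₁ s₂)
  (Finset.Icc (-M) M).biUnion fun m₂ =>
    let s := Int.sqrt (A * 2 ^ (2 * m + 1) - gram s₁ s₂ * m₂ ^ 2 - 1)
    (Finset.Icc (-((s + dot s₁ s₂ * m₂) / A)) ((s - dot s₁ s₂ * m₂) / A)).image fun m₁ =>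
      m₁ • s₁ + m₂ • s₂

/-- The lattice vectors enumerated when the frequency `k` is solved, where `n = m + ℓ`. If
`λ₂⊥ ≥ 2^{m - 1/2}`, only the shortest vector `s₁` is considered; otherwise all vectors of `𝓛(k)` of
norm less than `2^{m - 1/2}` are enumerated. -/
noncomputable def enumeratedVectors (m n : ℕ) (k : ℤ) : Finset (ℤ × ℤ) :=
  let s := reducedBasis n k
  if dot s.1 s.1 * 2 ^ (2 * m + 1) ≤ gram s.1 s.2 then {s.1} else shortVectors m s.1 s.2

/-- Each enumerated vector `w = (w₁, w₂)` gives the candidate `2 |w₂|` for `r / gcd(r, z)`. -/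
noncomputable def frequencyCandidates (m n : ℕ) (k : ℤ) : Finset ℕ :=
  (enumeratedVectors m n k).image fun w => w.2.natAbs

/-- The frequencies that are solved when `j` is observed: `j, j ± 1, …, j ± B` modulo `2^n`. -/
noncomputable def candidateFrequencies (n B : ℕ) (j : Fin (2 ^ n)) : Finset ℤ :=
  (Finset.Icc (-(B : ℤ)) (B : ℤ)).image fun t => (((j : ℕ) : ℤ) + t) % 2 ^ n

/-! ### From candidates for `r / gcd(r, z)` to candidates for `r`

`X` stands for `⌊c m⌋`: the primes up to `c m` are those up to `X`, and `⌊log_q (c m)⌋` is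
`Nat.log q X`. -/

/-- The primes up to `X`, in increasing order. -/
def primesUpTo (X : ℕ) : List ℕ := (List.range (X + 1)).filter fun q => q.Prime

section Recover

variable {G : Type*} [Group G] [DecidableEq G]

/-- For each prime `q` of the list in turn: push `(x, q, e)` with `e = ⌊log_q X⌋` onto the stack and
replace `x` by `x ^ (q ^ e)`; stop as soon as `x = 1`. -/
def climbUp (X : ℕ) : List ℕ → G → List (G × ℕ × ℕ) → G × List (G × ℕ × ℕ)
  | [], x, S => (x, S)
  | q :: qs, x, S =>
    if x ^ (q ^ Nat.log q X) = 1 then (x ^ (q ^ Nat.log q X), (x, q, Nat.log q X) :: S)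
    else climbUp X qs (x ^ (q ^ Nat.log q X)) ((x, q, Nat.log q X) :: S)

/-- At most `e` times, while `x ≠ 1`: replace `x` by `x ^ q` and `d` by `d * q`. Returns `d`. -/
def absorb (q : ℕ) : ℕ → G → ℕ → ℕ
  | 0, _, d => d
  | e + 1, x, d => if x = 1 then d else absorb q e (x ^ q) (d * q)

/-- Pop `(x, q, e)` off the stack until it is empty, each time replacing `x` by `x ^ d` and
then multiplying `d` by the power of `q` that is needed to kill `x`. -/
def backtrack : List (G × ℕ × ℕ) → ℕ → ℕ
  | [], d => d
  | (x, q, e) :: S, d => backtrack S (absorb q e (x ^ d) d)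

/-- Sequential algorithm that recovers `r = d * t` from `t = r / d` for `c m`-smooth `d`;
`none` signals failure. -/
def recoverSequential (g : G) (X m t : ℕ) : Option ℕ :=
  if 1 ≤ t ∧ t < 2 ^ m then
    if g ^ t = 1 then some t
    else if (climbUp X (primesUpTo X) (g ^ t) []).1 = 1 then
      some (backtrack (climbUp X (primesUpTo X) (g ^ t) []).2 1 * t)
    else none
  else none

/-- `∏_{q ∈ F} q ^ ⌊log_q X⌋`. -/
def powerProd (X : ℕ) (F : List ℕ) : ℕ := (F.map fun q => q ^ Nat.log q X).prod

/-- Binary tree: pairs each prime `q` of `F` with `x` raised to the product of the prime powers of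
all other primes of `F`. -/
def splitTree (X : ℕ) (x : G) (F : List ℕ) : List (ℕ × G) :=
  if F.length ≤ 1 then F.map fun q => (q, x)
  else
    splitTree X (x ^ powerProd X (F.drop (F.length / 2))) (F.take (F.length / 2)) ++
      splitTree X (x ^ powerProd X (F.take (F.length / 2))) (F.drop (F.length / 2))
termination_by F.length
decreasing_by
  · simp only [List.length_take]; omega
  · simp only [List.length_drop]; omega

/-- While `x ≠ 1`: replace `x` by `x ^ q` and `d` by `d * q`; fail if this is needed more than `e`
times. -/
def absorbOrFail (q : ℕ) : ℕ → G → ℕ → Option ℕ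
  | 0, x, d => if x = 1 then some d else none
  | e + 1, x, d => if x = 1 then some d else absorbOrFail q e (x ^ q) (d * q)

/-- Process all leaves of the tree, starting from `d`. -/
def absorbLeaves (X : ℕ) : List (ℕ × G) → ℕ → Option ℕ
  | [], d => some d
  | (q, x) :: T, d => (absorbOrFail q (Nat.log q X) x d).bind (absorbLeaves X T)

/-- Tree-based algorithm that recovers `r = d * t` from `t = r / d` for `c m`-smooth `d`;
`none` signals failure. -/
def recoverTree (g : G) (X m t : ℕ) : Option ℕ :=
  if 1 ≤ t ∧ t < 2 ^ m then
    (absorbLeaves X (splitTree X (g ^ t) (primesUpTo X)) 1).map fun d => d * t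
  else none

end Recover

/-! ### The whole algorithm -/

/-- The output of the classical part when the frequency `j` is observed: the minimum of the values
that `recover` returns on the candidates obtained from the frequencies `j, j ± 1, …, j ± B`
(`⊤` if there is none). Here `n = m + ℓ`. -/
noncomputable def classicalOutput (recover : ℕ → Option ℕ) (m n B : ℕ) (j : Fin (2 ^ n)) : WithTop ℕ :=
  ((candidateFrequencies n B j).biUnion fun k =>
    (frequencyCandidates m n k).biUnion fun t => (recover t).toFinset).min

/-- The probability that a single run of the quantum part, followed by the classical part, outputs
the order of `g`. -/
noncomputable def successProb {G : Type*} [Group G] [Fintype G] [DecidableEq G] (g : G)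
    (recover : ℕ → Option ℕ) (m n B : ℕ) : ℝ :=
  ∑ j : Fin (2 ^ n) with classicalOutput recover m n B j = (orderOf g : WithTop ℕ),
    frequencyProb g n j

end OrderFinding

namespace OrderFinding

/-! ### Lagrange reduction and enumeration -/

/-! Put n = m + ℓ. For every z in [0, r), the frequencies near 2^n z / r carry almost 1/r of the
probability, and observing one of them yields r unless gcd(r, z) has a large prime-power factor.

Quantum part. For a fixed group element g^e, the exponents a = e + r b give a geometric sum of about
u = 2^n / r terms. Comparison with its continuous analogue gives P(j) ≥ sinc²(π(j - 2^n z / r)) / r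
- 3 / 2^n for every integer z (`frequencyProb_ge`). The 2B + 1 integers around the peak miss at most
2 / (π² B) of the mass of sinc² (`le_sum_sinc_sq`), which follows from a finite form of ∑ 1/(φ + k)²
= π² / sin²(πφ). The windows of distinct z are disjoint modulo 2^n because 2B + 1 < 2^n / r
(`nearPeak_injOn`), so their contributions add up. This is stronger than the bound claimed, since 3
≤ π² and the terms in 1/B² and 1/B³ are not needed.

Lattice part. If j lies in the window of z, some candidate frequency is the peak k itself modulo
2^n. With x = r / gcd(r, z), the lattice of k has a primitive vector with second component x / 2 and
first component at most x / 2 in absolute value, hence of norm below 2^(m - 1/2). A Lagrange-reduced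
basis finds it up to sign (`natAbs_mem_frequencyCandidates`) and keeps the enumeration small
(`card_enumeratedVectors_le`).

Recovery. Both algorithms return only values orderOf (g ^ t) * t with t ≥ 1 (`RecoverSpec`). These
are positive multiples of r, so the minimum is r as soon as one candidate gives r
(`classicalOutput_nearPeak`). The candidate t = r / d with d = gcd(r, z) does so when d divides the
product of the prime powers q^(e_q). Otherwise some q^(e_q + 1) > c m divides both r and z. At most
m / log(c m) primes have such a power dividing r < 2^m, and each excludes at most a fraction 1/(c m)
of the z (`le_card_smooth`). -/

/-- The determinant of the matrix with rows `u` and `v`. -/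
def cross (u v : ℤ × ℤ) : ℤ := u.1 * v.2 - u.2 * v.1

lemma gram_eq (u v : ℤ × ℤ) : gram u v = 4 * cross u v ^ 2 := by
  unfold gram dot cross; ring

lemma dot_self_nonneg (u : ℤ × ℤ) : 0 ≤ dot u u := by
  unfold dot; nlinarith [mul_self_nonneg u.1, mul_self_nonneg u.2]

lemma dot_self_pos_of_cross {u v : ℤ × ℤ} (h : cross u v ≠ 0) : 0 < dot u u := by
  refine lt_of_le_of_ne (dot_self_nonneg u) fun h0 => h ?_
  unfold dot at h0
  have h1 : u.1 = 0 := by nlinarith [mul_self_nonneg u.1, mul_self_nonneg u.2]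
  have h2 : u.2 = 0 := by nlinarith [mul_self_nonneg u.1, mul_self_nonneg u.2]
  simp [cross, h1, h2]

lemma cross_sizeReduce (u v : ℤ × ℤ) : cross u (sizeReduce u v) = cross u v := by
  simp only [cross, sizeReduce, Prod.fst_sub, Prod.snd_sub, Prod.smul_fst, Prod.smul_snd,
    smul_eq_mul]
  ring

lemma cross_swap_sq (u v : ℤ × ℤ) : cross u v ^ 2 = cross v u ^ 2 := by
  unfold cross; ring

lemma two_mul_abs_dot_sizeReduce_le {u : ℤ × ℤ} (v : ℤ × ℤ) (hu : 0 < dot u u) :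
    2 * |dot u (sizeReduce u v)| ≤ dot u u := by
  have h1 : dot u (sizeReduce u v) =
      dot u v - round ((dot u v : ℚ) / (dot u u : ℚ)) * dot u u := by
    simp only [dot, sizeReduce, Prod.fst_sub, Prod.snd_sub, Prod.smul_fst, Prod.smul_snd,
      smul_eq_mul]
    ring
  have hu' : (0 : ℚ) < dot u u := by exact_mod_cast hu
  have h2 := abs_sub_round ((dot u v : ℚ) / (dot u u : ℚ))
  rw [h1]
  set c := round ((dot u v : ℚ) / (dot u u : ℚ))
  have h3 : ((dot u v - c * dot u u : ℤ) : ℚ) = ((dot u v : ℚ) / (dot u u : ℚ) - c) * dot u u := by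
    push_cast; field_simp
  have h4 : (2 : ℚ) * |((dot u v - c * dot u u : ℤ) : ℚ)| ≤ dot u u := by
    rw [h3, abs_mul, abs_of_pos hu']; nlinarith
  exact_mod_cast h4

lemma span_sizeReduce (u v : ℤ × ℤ) :
    Submodule.span ℤ {u, sizeReduce u v} = Submodule.span ℤ {u, v} := by
  apply le_antisymm <;> rw [Submodule.span_le, Set.pair_subset_iff] <;>
    refine ⟨Submodule.subset_span (by simp), Submodule.mem_span_pair.2 ?_⟩
  · exact ⟨-round ((dot u v : ℚ) / (dot u u : ℚ)), 1, by unfold sizeReduce; module⟩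
  · exact ⟨round ((dot u v : ℚ) / (dot u u : ℚ)), 1, by unfold sizeReduce; module⟩

/-- Lagrange's algorithm returns a reduced basis of the lattice it is given. -/
theorem lagrange_spec (u v : ℤ × ℤ) (h : cross u v ≠ 0) :
    Submodule.span ℤ {(lagrange u v).1, (lagrange u v).2} = Submodule.span ℤ {u, v} ∧
    cross (lagrange u v).1 (lagrange u v).2 ^ 2 = cross u v ^ 2 ∧
    2 * |dot (lagrange u v).1 (lagrange u v).2| ≤ dot (lagrange u v).1 (lagrange u v).1 ∧
    dot (lagrange u v).1 (lagrange u v).1 ≤ dot (lagrange u v).2 (lagrange u v).2 := by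
  induction u, v using lagrange.induct with
  | case1 u v hlt ih =>
    have h' : cross (sizeReduce u v) u ^ 2 = cross u v ^ 2 := by
      rw [cross_swap_sq, cross_sizeReduce]
    have := ih fun h0 => h (by rw [h0] at h'; exact pow_eq_zero_iff two_ne_zero |>.1 h'.symm)
    rw [lagrange, if_pos hlt]
    refine ⟨?_, ?_, this.2.2⟩
    · rw [this.1, Set.pair_comm, span_sizeReduce]
    · rw [this.2.1, h']
  -- On exit, the first reducedness condition comes from rounding to the nearest integer and the
  -- second is the failed loop test.
  | case2 u v hlt =>
    rw [lagrange, if_neg hlt]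
    exact ⟨span_sizeReduce u v, by rw [cross_sizeReduce],
      two_mul_abs_dot_sizeReduce_le v (dot_self_pos_of_cross h), not_lt.1 hlt⟩

lemma cross_generators (n : ℕ) (k : ℤ) : cross (k, 1) (2 ^ n, 0) = -2 ^ n := by
  simp [cross]

/-- The Gram determinant is a lattice invariant. In a reduced basis (dot s₁ s₂)² is at most a
quarter of (dot s₁ s₁)² while dot s₂ s₂ ≥ dot s₁ s₁, so at least 3/4 of (dot s₁ s₁)² survives in it.
-/
lemma reducedBasis_spec (n : ℕ) (k : ℤ) :
    Submodule.span ℤ {(reducedBasis n k).1, (reducedBasis n k).2} =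
      Submodule.span ℤ {((k, 1) : ℤ × ℤ), (2 ^ n, 0)} ∧
    gram (reducedBasis n k).1 (reducedBasis n k).2 = 2 ^ (2 * n + 2) ∧
    0 < dot (reducedBasis n k).1 (reducedBasis n k).1 ∧
    3 * dot (reducedBasis n k).1 (reducedBasis n k).1 ^ 2 ≤
      4 * gram (reducedBasis n k).1 (reducedBasis n k).2 := by
  have h0 : cross (k, 1) (2 ^ n, 0) ≠ 0 := by simp [cross_generators]
  obtain ⟨h1, h2, h3, h4⟩ := lagrange_spec _ _ h0
  change Submodule.span ℤ {(reducedBasis n k).1, (reducedBasis n k).2} = _ at h1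
  change cross (reducedBasis n k).1 (reducedBasis n k).2 ^ 2 = _ at h2
  change 2 * |dot (reducedBasis n k).1 (reducedBasis n k).2| ≤
    dot (reducedBasis n k).1 (reducedBasis n k).1 at h3
  change dot (reducedBasis n k).1 (reducedBasis n k).1 ≤
    dot (reducedBasis n k).2 (reducedBasis n k).2 at h4
  rw [cross_generators] at h2
  refine ⟨h1, ?_, ?_, ?_⟩
  · rw [gram_eq, h2, neg_sq]; ring
  · refine dot_self_pos_of_cross (v := (reducedBasis n k).2) fun h => ?_
    rw [h] at h2
    have : (0 : ℤ) < 2 ^ n := by positivity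
    nlinarith
  · have hA := dot_self_nonneg (reducedBasis n k).1
    have h5 : 4 * dot (reducedBasis n k).1 (reducedBasis n k).2 ^ 2 ≤
        dot (reducedBasis n k).1 (reducedBasis n k).1 ^ 2 := by
      rw [← sq_abs (dot _ (reducedBasis n k).2)]
      nlinarith [abs_nonneg (dot (reducedBasis n k).1 (reducedBasis n k).2)]
    unfold gram
    nlinarith

lemma int_sqrt_bounds {x : ℤ} (hx : 0 ≤ x) : 0 ≤ Int.sqrt x ∧ Int.sqrt x ^ 2 ≤ x ∧
    ∀ y : ℤ, y ^ 2 ≤ x → |y| ≤ Int.sqrt x := by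
  lift x to ℕ using hx
  refine ⟨Int.sqrt_nonneg _, ?_, fun y hy => ?_⟩
  · simp only [Int.sqrt, Int.toNat_natCast]
    exact_mod_cast Nat.sqrt_le' x
  · simp only [Int.sqrt, Int.toNat_natCast]
    rw [Int.abs_eq_natAbs]
    have : y.natAbs ^ 2 ≤ x := by zify; simpa using hy
    exact_mod_cast Nat.le_sqrt'.2 this

/-- Completing the square in m₁ separates the two loops. Strict integer inequalities become x² ≤ N -
1, which is what the integer square roots test. -/
lemma mem_shortVectors {m : ℕ} {s₁ s₂ : ℤ × ℤ} (hA : 0 < dot s₁ s₁) (hg : 0 < gram s₁ s₂)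
    (m₁ m₂ : ℤ) (h : dot (m₁ • s₁ + m₂ • s₂) (m₁ • s₁ + m₂ • s₂) < 2 ^ (2 * m + 1)) :
    m₁ • s₁ + m₂ • s₂ ∈ shortVectors m s₁ s₂ := by
  have key : dot s₁ s₁ * dot (m₁ • s₁ + m₂ • s₂) (m₁ • s₁ + m₂ • s₂) =
      (dot s₁ s₁ * m₁ + dot s₁ s₂ * m₂) ^ 2 + gram s₁ s₂ * m₂ ^ 2 := by
    simp only [gram, dot, Prod.fst_add, Prod.snd_add, Prod.smul_fst, Prod.smul_snd, smul_eq_mul]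
    ring
  have hlt := mul_lt_mul_of_pos_left h hA
  rw [key] at hlt
  have hT : (0 : ℤ) < dot s₁ s₁ * 2 ^ (2 * m + 1) := by positivity
  simp only [shortVectors, Finset.mem_biUnion, Finset.mem_image, Finset.mem_Icc]
  refine ⟨m₂, ?_, m₁, ?_, rfl⟩
  · rw [← abs_le]
    refine (int_sqrt_bounds (Int.ediv_nonneg (by omega) hg.le)).2.2 _ ?_
    rw [Int.le_ediv_iff_mul_le hg]
    nlinarith [sq_nonneg (dot s₁ s₁ * m₁ + dot s₁ s₂ * m₂)]
  · have := (int_sqrt_bounds (x := dot s₁ s₁ * 2 ^ (2 * m + 1) - gram s₁ s₂ * m₂ ^ 2 - 1)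
      (by nlinarith [sq_nonneg (dot s₁ s₁ * m₁ + dot s₁ s₂ * m₂)])).2.2
      (dot s₁ s₁ * m₁ + dot s₁ s₂ * m₂) (by linarith)
    rw [abs_le] at this
    constructor
    · rw [neg_le, Int.le_ediv_iff_mul_le hA]; linarith
    · rw [Int.le_ediv_iff_mul_le hA]; linarith

lemma mem_span_of_mem_shortVectors {m : ℕ} {s₁ s₂ w : ℤ × ℤ} (h : w ∈ shortVectors m s₁ s₂) :
    w ∈ Submodule.span ℤ {s₁, s₂} := by
  simp only [shortVectors, Finset.mem_biUnion, Finset.mem_image] at h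
  obtain ⟨m₂, -, m₁, -, rfl⟩ := h
  exact Submodule.mem_span_pair.2 ⟨m₁, m₂, rfl⟩

lemma toVec_mem_lattice {n : ℕ} {k : ℤ} {w : ℤ × ℤ}
    (h : w ∈ Submodule.span ℤ {((k, 1) : ℤ × ℤ), (2 ^ n, 0)}) : toVec w ∈ lattice n k := by
  obtain ⟨a, b, rfl⟩ := Submodule.mem_span_pair.1 h
  refine Submodule.mem_span_pair.2 ⟨a, b, ?_⟩
  ext i
  fin_cases i <;> simp [toVec]
  ring

theorem toVec_mem_lattice_of_mem_enumeratedVectors {m n : ℕ} {k : ℤ} {w : ℤ × ℤ}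
    (h : w ∈ enumeratedVectors m n k) : toVec w ∈ lattice n k := by
  apply toVec_mem_lattice
  rw [← (reducedBasis_spec n k).1]
  simp only [enumeratedVectors] at h
  split_ifs at h
  · rw [Finset.mem_singleton.1 h]
    exact Submodule.subset_span (by simp)
  · exact mem_span_of_mem_shortVectors h

/-- A short vector with coprime coefficients is enumerated, up to sign. -/
theorem natAbs_mem_frequencyCandidates {m n : ℕ} {k x y : ℤ} (hxy : IsCoprime x y)
    (h : 4 * (x * k + y * 2 ^ n) ^ 2 + x ^ 2 < 2 ^ (2 * m + 1)) :
    x.natAbs ∈ frequencyCandidates m n k := by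
  obtain ⟨h1, h2, h3, -⟩ := reducedBasis_spec n k
  set s₁ := (reducedBasis n k).1 with hs₁
  set s₂ := (reducedBasis n k).2 with hs₂
  have hg : 0 < gram s₁ s₂ := by rw [h2]; positivity
  have hw : x • ((k, 1) : ℤ × ℤ) + y • ((2 ^ n, 0) : ℤ × ℤ) ∈ Submodule.span ℤ {s₁, s₂} := by
    rw [h1]; exact Submodule.mem_span_pair.2 ⟨x, y, rfl⟩
  obtain ⟨m₁, m₂, hm⟩ := Submodule.mem_span_pair.1 hw
  have hdot : dot (m₁ • s₁ + m₂ • s₂) (m₁ • s₁ + m₂ • s₂) < 2 ^ (2 * m + 1) := by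
    rw [hm]
    refine lt_of_eq_of_lt ?_ h
    simp only [dot, Prod.fst_add, Prod.snd_add, Prod.smul_fst, Prod.smul_snd, smul_eq_mul]
    ring
  simp only [frequencyCandidates, enumeratedVectors, Finset.mem_image]
  rw [← hs₁, ← hs₂]
  split_ifs with hc
  · refine ⟨s₁, by simp, ?_⟩
    have key : dot s₁ s₁ * dot (m₁ • s₁ + m₂ • s₂) (m₁ • s₁ + m₂ • s₂) =
        (dot s₁ s₁ * m₁ + dot s₁ s₂ * m₂) ^ 2 + gram s₁ s₂ * m₂ ^ 2 := by
      simp only [gram, dot, Prod.fst_add, Prod.snd_add, Prod.smul_fst, Prod.smul_snd, smul_eq_mul]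
      ring
    have hlt := mul_lt_mul_of_pos_left hdot h3
    rw [key] at hlt
    -- A nonzero m₂ would contribute at least the whole Gram determinant, which already reaches the
    -- bound.
    have hm2 : m₂ = 0 := by
      by_contra h0
      have : 0 < m₂ ^ 2 := by positivity
      nlinarith [sq_nonneg (dot s₁ s₁ * m₁ + dot s₁ s₂ * m₂)]
    obtain ⟨a, b, hab⟩ := Submodule.mem_span_pair.1
      (show s₁ ∈ Submodule.span ℤ {((k, 1) : ℤ × ℤ), (2 ^ n, 0)} by
        rw [← h1]; exact Submodule.subset_span (by simp))
    rw [hm2, zero_smul, add_zero, ← hab] at hm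
    have e1 := congrArg Prod.fst hm
    have e2 := congrArg Prod.snd hm
    simp at e1 e2
    have e3 : m₁ * b = y := by
      have : (2 : ℤ) ^ n ≠ 0 := by positivity
      apply mul_right_cancel₀ this
      subst e2
      linarith
    -- Coprime coefficients make the short vector primitive, so it equals ± s₁ and not a larger
    -- multiple.
    have hu : IsUnit m₁ := hxy.isUnit_of_dvd' ⟨a, e2.symm⟩ ⟨b, e3.symm⟩
    rw [← hab, ← e2, Int.natAbs_mul, Int.isUnit_iff_natAbs_eq.1 hu]
    simp
  · refine ⟨_, mem_shortVectors h3 hg m₁ m₂ hdot, ?_⟩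
    rw [hm]; simp

/-- The shift d cancels in the length of the interval. If the interval is empty, `toNat` truncates
to 0 and the bound is trivial. -/
lemma card_inner_le {A s d : ℤ} (hA : 0 < A) (hs : 0 ≤ s) :
    ((Finset.Icc (-((s + d) / A)) ((s - d) / A)).card : ℝ) ≤ 2 * s / A + 1 := by
  have hA' : (0 : ℝ) < A := by exact_mod_cast hA
  have h1 : (((s + d) / A : ℤ) : ℝ) ≤ (s + d) / A := by
    rw [le_div_iff₀ hA']; exact_mod_cast Int.ediv_mul_le _ hA.ne'
  have h2 : (((s - d) / A : ℤ) : ℝ) ≤ (s - d) / A := by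
    rw [le_div_iff₀ hA']; exact_mod_cast Int.ediv_mul_le _ hA.ne'
  rw [Int.card_Icc]
  have h3 : (0 : ℝ) ≤ 2 * s / A + 1 := by
    have : (0 : ℝ) ≤ s := by exact_mod_cast hs
    positivity
  rcases le_total 0 ((s - d) / A + 1 - -((s + d) / A)) with h | h
  · rw [← Int.cast_natCast, Int.toNat_of_nonneg h]
    push_cast
    have : (2 * s / A : ℝ) = (s + d) / A + (s - d) / A := by ring
    linarith
  · rw [Int.toNat_of_nonpos h]; simpa using h3

/-- Dropping the nonnegative term in m₂² bounds every inner loop uniformly by its size at m₂ = 0. -/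
lemma card_shortVectors_le {m : ℕ} {s₁ s₂ : ℤ × ℤ} (hA : 0 < dot s₁ s₁) (hg : 0 < gram s₁ s₂) :
    ((shortVectors m s₁ s₂).card : ℝ) ≤
      (2 * √((dot s₁ s₁ * 2 ^ (2 * m + 1) : ℝ) / gram s₁ s₂) + 1) *
        (2 * √((2 : ℝ) ^ (2 * m + 1) / dot s₁ s₁) + 1) := by
  simp only [shortVectors]
  set A := dot s₁ s₁
  set g := gram s₁ s₂
  have hA' : (0 : ℝ) < A := by exact_mod_cast hA
  have hg' : (0 : ℝ) < g := by exact_mod_cast hg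
  have hT : (0 : ℤ) < A * 2 ^ (2 * m + 1) := by positivity
  obtain ⟨hM0, hM, -⟩ := int_sqrt_bounds
    (x := (A * 2 ^ (2 * m + 1) - 1) / g) (Int.ediv_nonneg (by omega) hg.le)
  set M := Int.sqrt ((A * 2 ^ (2 * m + 1) - 1) / g)
  rw [Int.le_ediv_iff_mul_le hg] at hM
  have hMr : (M : ℝ) ≤ √((A * 2 ^ (2 * m + 1) : ℝ) / g) := by
    apply Real.le_sqrt_of_sq_le
    rw [le_div_iff₀ hg']
    exact_mod_cast (by linarith : M ^ 2 * g ≤ A * 2 ^ (2 * m + 1))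
  calc _ ≤ ∑ m₂ ∈ Finset.Icc (-M) M, (2 * √((2 : ℝ) ^ (2 * m + 1) / A) + 1) := by
        refine (Nat.cast_le.2 Finset.card_biUnion_le).trans ?_
        rw [Nat.cast_sum]
        refine Finset.sum_le_sum fun m₂ hm₂ => ?_
        refine (Nat.cast_le.2 Finset.card_image_le).trans ?_
        have hm₂' : m₂ ^ 2 ≤ M ^ 2 := by
          rw [Finset.mem_Icc] at hm₂
          exact sq_le_sq' hm₂.1 hm₂.2
        obtain ⟨hs0, hs, -⟩ := int_sqrt_bounds
          (x := A * 2 ^ (2 * m + 1) - g * m₂ ^ 2 - 1) (by nlinarith)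
        refine (card_inner_le hA hs0).trans ?_
        set s := Int.sqrt (A * 2 ^ (2 * m + 1) - g * m₂ ^ 2 - 1)
        have : (s : ℝ) / A ≤ √((2 : ℝ) ^ (2 * m + 1) / A) := by
          apply Real.le_sqrt_of_sq_le
          rw [div_pow, div_le_div_iff₀ (by positivity) hA']
          have h1 : (s : ℝ) ^ 2 ≤ A * 2 ^ (2 * m + 1) := by
            exact_mod_cast (by nlinarith [sq_nonneg m₂] : s ^ 2 ≤ A * 2 ^ (2 * m + 1))
          nlinarith
        rw [mul_div_assoc]
        linarith
    _ = (2 * M + 1) * (2 * √((2 : ℝ) ^ (2 * m + 1) / A) + 1) := by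
        rw [Finset.sum_const, nsmul_eq_mul, Int.card_Icc]
        congr 1
        rw [← Int.cast_natCast, Int.toNat_of_nonneg (by omega)]
        push_cast; ring
    _ ≤ _ := by gcongr

/-- The count is at most (2a + 1)(2b + 1), where ab = 2^Δ by the determinant. Being in the
enumeration branch gives a ≥ 1 and, with reducedness, b ≥ √3 / 2. Absorbing the two ones into a and
b leaves (6 + 2√3) ab ≤ 6√3 ab. -/
theorem card_enumeratedVectors_le {m Δ n : ℕ} (k : ℤ) (hn : n + Δ = 2 * m) :
    ((enumeratedVectors m n k).card : ℝ) ≤ 6 * √3 * 2 ^ Δ := by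
  obtain ⟨-, h2, h3, h4⟩ := reducedBasis_spec n k
  have h3pos : (1 : ℝ) ≤ √3 := Real.one_le_sqrt.2 (by norm_num)
  have h33 : √3 * √3 = (3 : ℝ) := Real.mul_self_sqrt (by norm_num)
  have hΔ : (1 : ℝ) ≤ 2 ^ Δ := one_le_pow₀ (by norm_num)
  simp only [enumeratedVectors]
  split_ifs with hc
  · rw [Finset.card_singleton]; push_cast; nlinarith
  rw [not_le] at hc
  have hg : 0 < gram (reducedBasis n k).1 (reducedBasis n k).2 := by rw [h2]; positivity
  refine (card_shortVectors_le h3 hg).trans ?_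
  set A := dot (reducedBasis n k).1 (reducedBasis n k).1
  set g := gram (reducedBasis n k).1 (reducedBasis n k).2
  have hA' : (0 : ℝ) < A := by exact_mod_cast h3
  have hg' : (0 : ℝ) < g := by exact_mod_cast hg
  have hc' : (g : ℝ) < A * 2 ^ (2 * m + 1) := by exact_mod_cast hc
  have h4' : 3 * (A : ℝ) ^ 2 ≤ 4 * g := by exact_mod_cast h4
  have hgr : (g : ℝ) = 2 ^ (2 * n + 2) := by exact_mod_cast h2
  set a := √((A * 2 ^ (2 * m + 1) : ℝ) / g) with ha
  set b := √((2 : ℝ) ^ (2 * m + 1) / A) with hb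
  have ha1 : 1 ≤ a := by
    rw [ha, Real.one_le_sqrt, le_div_iff₀ hg']; linarith
  have hb1 : √3 ≤ 2 * b := by
    have : √3 / 2 ≤ b := by
      apply Real.le_sqrt_of_sq_le
      rw [div_pow, Real.sq_sqrt (by norm_num), le_div_iff₀ hA']
      nlinarith
    linarith
  have hab : a * b = 2 ^ Δ := by
    rw [ha, hb, ← Real.sqrt_mul (by positivity), Real.sqrt_eq_iff_mul_self_eq (by positivity)
      (by positivity), hgr, ← pow_add, div_mul_div_comm, mul_assoc, ← pow_add,
      mul_comm _ (A : ℝ), mul_div_mul_left _ _ hA'.ne', div_eq_iff (by positivity), ← pow_add]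
    congr 1; omega
  have h5 : 1 ≤ √3 * 2 / 3 * b := by nlinarith
  calc (2 * a + 1) * (2 * b + 1) ≤ (3 * a) * (2 * b + √3 * 2 / 3 * b) := by
        gcongr; linarith
    _ = (6 + 2 * √3) * (a * b) := by ring
    _ ≤ 6 * √3 * 2 ^ Δ := by rw [hab]; gcongr; nlinarith

/-! ### Recovery of the order from a candidate -/

section Recover

variable {G : Type*} [Group G]

/-- One pass of the absorbing loops: for a nontrivial element of q-power order, raising to the power
q removes exactly one factor q from the order. -/
lemma orderOf_dvd_or {q e : ℕ} (hq : q.Prime) {x : G} (h : orderOf x ∣ q ^ (e + 1)) (hx : x ≠ 1) :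
    orderOf x = q * orderOf (x ^ q) ∧ orderOf (x ^ q) ∣ q ^ e := by
  have hd : q ∣ orderOf x := by
    obtain ⟨i, -, hi⟩ := (Nat.dvd_prime_pow hq).1 h
    rcases i with _ | i
    · exact absurd (orderOf_eq_one_iff.1 (by simpa using hi)) hx
    · rw [hi]; exact dvd_pow_self q (Nat.succ_ne_zero i)
  have h1 : orderOf (x ^ q) = orderOf x / q := orderOf_pow_of_dvd hq.ne_zero hd
  refine ⟨by rw [h1, Nat.mul_div_cancel' hd], ?_⟩
  rw [orderOf_dvd_iff_pow_eq_one, ← pow_mul, ← pow_succ', ← orderOf_dvd_iff_pow_eq_one]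
  exact h

/-- The order is the product of its gcds with a and b, and raising to the power b removes the second
of them. This justifies one branching of the tree. -/
lemma orderOf_eq_mul_of_coprime [Finite G] {a b : ℕ} (hab : a.Coprime b) {x : G}
    (h : orderOf x ∣ a * b) : orderOf x = orderOf (x ^ b) * orderOf (x ^ a) := by
  have hn : orderOf x = (orderOf x).gcd a * (orderOf x).gcd b := by
    rw [← hab.gcd_mul, Nat.gcd_eq_left h]
  have h0 : 0 < orderOf x := orderOf_pos x
  have ha : 0 < (orderOf x).gcd a := Nat.gcd_pos_of_pos_left _ h0
  have hb : 0 < (orderOf x).gcd b := Nat.gcd_pos_of_pos_left _ h0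
  have e1 : orderOf x / (orderOf x).gcd b = (orderOf x).gcd a :=
    Nat.div_eq_of_eq_mul_left hb hn
  have e2 : orderOf x / (orderOf x).gcd a = (orderOf x).gcd b :=
    Nat.div_eq_of_eq_mul_right ha hn
  rw [orderOf_pow, orderOf_pow, e1, e2]
  exact hn

/-- One step of the backtracking: once the order d of x ^ n is known, only the order of x ^ d
remains to be found. -/
lemma orderOf_eq_orderOf_pow_mul (x : G) (n : ℕ) (hx : IsOfFinOrder x) :
    orderOf x = orderOf (x ^ n) * orderOf (x ^ orderOf (x ^ n)) := by
  have hd : orderOf (x ^ n) ∣ orderOf x := orderOf_pow_dvd n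
  have h0 : orderOf (x ^ n) ≠ 0 := fun h =>
    hx.orderOf_pos.ne' (Nat.eq_zero_of_zero_dvd (h ▸ hd))
  rw [orderOf_pow_of_dvd h0 hd, Nat.mul_div_cancel' hd]

variable [DecidableEq G]

/-- `absorb` stops silently when its budget runs out, so the order must be known in advance to
divide q ^ e. `absorbOrFail` tests this itself. -/
lemma absorb_eq {q : ℕ} (hq : q.Prime) (e : ℕ) (x : G) (d : ℕ) (h : orderOf x ∣ q ^ e) :
    absorb q e x d = d * orderOf x := by
  induction e generalizing x d with
  | zero =>
    have h1 : orderOf x = 1 := by simpa [-orderOf_eq_one_iff] using h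
    rw [absorb, h1, mul_one]
  | succ e ih =>
    rw [absorb]
    split_ifs with hx
    · simp [hx]
    · obtain ⟨h1, h2⟩ := orderOf_dvd_or hq h hx
      rw [ih _ _ h2, h1, mul_assoc]

lemma absorbOrFail_eq {q : ℕ} (hq : q.Prime) (e : ℕ) (x : G) (d : ℕ) :
    absorbOrFail q e x d = if orderOf x ∣ q ^ e then some (d * orderOf x) else none := by
  induction e generalizing x d with
  | zero =>
    rw [absorbOrFail]
    by_cases hx : x = 1 <;> simp [hx, orderOf_eq_one_iff]
  | succ e ih =>
    rw [absorbOrFail]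
    by_cases hx : x = 1
    · simp [hx]
    rw [if_neg hx, ih]
    by_cases h : orderOf x ∣ q ^ (e + 1)
    · obtain ⟨h1, h2⟩ := orderOf_dvd_or hq h hx
      rw [if_pos h, if_pos h2, h1, mul_assoc]
    · rw [if_neg h, if_neg]
      rwa [orderOf_dvd_iff_pow_eq_one, ← pow_mul, ← pow_succ', ← orderOf_dvd_iff_pow_eq_one]

lemma absorbLeaves_append (X : ℕ) (T₁ T₂ : List (ℕ × G)) (d : ℕ) :
    absorbLeaves X (T₁ ++ T₂) d = (absorbLeaves X T₁ d).bind (absorbLeaves X T₂) := by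
  induction T₁ generalizing d with
  | nil => simp [absorbLeaves]
  | cons a T ih =>
    obtain ⟨q, x⟩ := a
    rw [List.cons_append, absorbLeaves, absorbLeaves, Option.bind_assoc]
    congr 1
    funext d'
    exact ih d'

lemma powerProd_append (X : ℕ) (F₁ F₂ : List ℕ) :
    powerProd X (F₁ ++ F₂) = powerProd X F₁ * powerProd X F₂ := by
  simp [powerProd]

lemma powerProd_coprime {X : ℕ} {F₁ F₂ : List ℕ} (h₁ : ∀ q ∈ F₁, q.Prime)
    (h₂ : ∀ q ∈ F₂, q.Prime) (h : List.Disjoint F₁ F₂) :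
    (powerProd X F₁).Coprime (powerProd X F₂) := by
  unfold powerProd
  rw [Nat.coprime_list_prod_left_iff]
  intro a ha
  rw [Nat.coprime_list_prod_right_iff]
  intro b hb
  obtain ⟨p, hp, rfl⟩ := List.mem_map.1 ha
  obtain ⟨q, hq, rfl⟩ := List.mem_map.1 hb
  refine Nat.Coprime.pow _ _ ((Nat.coprime_primes (h₁ p hp) (h₂ q hq)).2 ?_)
  rintro rfl
  exact h hp hq

/-- Success in either half is equivalent to the order of x dividing the full product, and the orders
found in the two halves multiply by coprimality. The list must be nonempty: without leaves nothing
is tested and d is returned unconditionally. -/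
lemma absorbLeaves_splitTree [Finite G] {X : ℕ} (x : G) (F : List ℕ) (hF : ∀ q ∈ F, q.Prime) (hnd : F.Nodup)
    (hne : F ≠ []) (d : ℕ) :
    absorbLeaves X (splitTree X x F) d =
      if orderOf x ∣ powerProd X F then some (d * orderOf x) else none := by
  induction x, F using @splitTree.induct G _ X generalizing d with
  | case1 x F hlen =>
    obtain ⟨q, rfl⟩ : ∃ q, F = [q] :=
      List.length_eq_one_iff.1 (le_antisymm hlen (List.length_pos_iff.2 hne))
    rw [splitTree, if_pos hlen]
    simp only [List.map_cons, List.map_nil, absorbLeaves,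
      absorbOrFail_eq (hF q (by simp)), powerProd, List.prod_cons, List.prod_nil, mul_one]
    split_ifs <;> simp
  | case2 x F hlen ih1 ih2 =>
    rw [splitTree, if_neg hlen, absorbLeaves_append]
    have hsplit := List.take_append_drop (F.length / 2) F
    have hprod := powerProd_append X (F.take (F.length / 2)) (F.drop (F.length / 2))
    rw [hsplit] at hprod
    have hp1 : ∀ q ∈ F.take (F.length / 2), q.Prime := fun q h => hF q (List.mem_of_mem_take h)
    have hp2 : ∀ q ∈ F.drop (F.length / 2), q.Prime := fun q h => hF q (List.mem_of_mem_drop h)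
    have hn := hnd
    rw [← hsplit, List.nodup_append'] at hn
    have hco : (powerProd X (F.take (F.length / 2))).Coprime
      (powerProd X (F.drop (F.length / 2))) := powerProd_coprime hp1 hp2 hn.2.2
    rw [ih1 hp1 hn.1 (by rw [← List.length_pos_iff, List.length_take]; omega)]
    have e1 : orderOf (x ^ powerProd X (F.drop (F.length / 2))) ∣
        powerProd X (F.take (F.length / 2)) ↔ orderOf x ∣ powerProd X F := by
      rw [orderOf_dvd_iff_pow_eq_one, ← pow_mul, mul_comm, ← hprod, orderOf_dvd_iff_pow_eq_one]
    have e2 : orderOf (x ^ powerProd X (F.take (F.length / 2))) ∣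
        powerProd X (F.drop (F.length / 2)) ↔ orderOf x ∣ powerProd X F := by
      rw [orderOf_dvd_iff_pow_eq_one, ← pow_mul, ← hprod, orderOf_dvd_iff_pow_eq_one]
    rw [if_congr e1 rfl rfl]
    split_ifs with h
    · rw [Option.bind_some,
        ih2 hp2 hn.2.1 (by rw [← List.length_pos_iff, List.length_drop]; omega),
        if_pos (e2.2 h), orderOf_eq_mul_of_coprime hco (x := x) (hprod ▸ h), mul_assoc]
    · rfl

/-- Invariant of the stack of the sequential algorithm: `x` is the current element, and `x₀` the
initial one. -/
inductive IsStack (x₀ : G) : G → List (G × ℕ × ℕ) → Prop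
  | nil : IsStack x₀ x₀ []
  | cons {x : G} {S : List (G × ℕ × ℕ)} {q e : ℕ} (hq : q.Prime) (h : IsStack x₀ x S) :
      IsStack x₀ (x ^ q ^ e) ((x, q, e) :: S)

lemma backtrack_eq [Finite G] {x₀ x : G} {S : List (G × ℕ × ℕ)} (h : IsStack x₀ x S) :
    backtrack S (orderOf x) = orderOf x₀ := by
  induction h with
  | nil => rfl
  | @cons x S q e hq h ih =>
    rw [backtrack, absorb_eq hq, ← orderOf_eq_orderOf_pow_mul x _ (isOfFinOrder_of_finite x), ih]
    -- With d the order of x ^ q ^ e, exchanging exponents shows that q ^ e kills x ^ d, so the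
    -- budget of `absorb` suffices.
    rw [orderOf_dvd_iff_pow_eq_one, pow_right_comm, pow_orderOf_eq_one]

lemma isStack_climbUp {X : ℕ} {x₀ x : G} {F : List ℕ} {S : List (G × ℕ × ℕ)}
    (hF : ∀ q ∈ F, q.Prime) (h : IsStack x₀ x S) :
    IsStack x₀ (climbUp X F x S).1 (climbUp X F x S).2 := by
  induction F generalizing x S with
  | nil => exact h
  | cons q F ih =>
    rw [climbUp]
    have h' := h.cons (hF q (by simp)) (e := Nat.log q X)
    split_ifs
    · exact h'
    · exact ih (fun q hq => hF q (by simp [hq])) h'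

/-- An early stop is harmless, since it happens only at the value 1. -/
lemma climbUp_eq_one {X : ℕ} {x : G} {F : List ℕ} (S : List (G × ℕ × ℕ))
    (h : x ^ powerProd X F = 1) : (climbUp X F x S).1 = 1 := by
  induction F generalizing x S with
  | nil => simpa [powerProd, climbUp] using h
  | cons q F ih =>
    rw [climbUp]
    split_ifs with h1
    · exact h1
    · apply ih
      rw [← pow_mul]
      simpa [powerProd] using h

lemma prime_of_mem_primesUpTo {X q : ℕ} (h : q ∈ primesUpTo X) : q.Prime := by
  simpa using (List.mem_filter.1 h).2

lemma nodup_primesUpTo (X : ℕ) : (primesUpTo X).Nodup := List.nodup_range.filter _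

lemma primesUpTo_ne_nil {X : ℕ} (hX : 2 ≤ X) : primesUpTo X ≠ [] :=
  List.ne_nil_of_mem (a := 2) (by simp [primesUpTo, Nat.prime_two]; omega)

/-- Every value returned is the order of `g ^ t` times `t`, and a value is returned if the order of
`g ^ t` divides the product of the prime powers. -/
structure RecoverSpec (g : G) (X m : ℕ) (recover : ℕ → Option ℕ) : Prop where
  eq_of_mem : ∀ t v, recover t = some v → 1 ≤ t ∧ v = orderOf (g ^ t) * t
  of_dvd : ∀ t, 1 ≤ t → t < 2 ^ m → orderOf (g ^ t) ∣ powerProd X (primesUpTo X) →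
    recover t = some (orderOf (g ^ t) * t)

theorem recoverTree_spec [Finite G] (g : G) {X : ℕ} (hX : 2 ≤ X) (m : ℕ) :
    RecoverSpec g X m (recoverTree g X m) := by
  have key (t : ℕ) := absorbLeaves_splitTree (X := X) (g ^ t) (primesUpTo X)
    (fun _ => prime_of_mem_primesUpTo) (nodup_primesUpTo X) (primesUpTo_ne_nil hX) 1
  constructor
  · intro t v h
    rw [recoverTree, key] at h
    split_ifs at h with h1 h2
    · simp at h
      exact ⟨h1.1, h.symm⟩
    all_goals simp at h
  · intro t h1 h2 h3
    rw [recoverTree, key, if_pos ⟨h1, h2⟩, if_pos h3]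
    simp

theorem recoverSequential_spec [Finite G] (g : G) (X m : ℕ) :
    RecoverSpec g X m (recoverSequential g X m) := by
  have key (t : ℕ) (h : (climbUp X (primesUpTo X) (g ^ t) []).1 = 1) :
      backtrack (climbUp X (primesUpTo X) (g ^ t) []).2 1 = orderOf (g ^ t) := by
    have := backtrack_eq (isStack_climbUp (X := X) (F := primesUpTo X)
      (fun _ => prime_of_mem_primesUpTo) (IsStack.nil (x₀ := g ^ t)))
    rwa [h, orderOf_one] at this
  constructor
  · intro t v h
    rw [recoverSequential] at h
    split_ifs at h with h1 h2 h3
    · simp at h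
      exact ⟨h1.1, by rw [h2, orderOf_one, one_mul, h]⟩
    · rw [key t h3] at h
      simp at h
      exact ⟨h1.1, h.symm⟩
  · intro t h1 h2 h3
    rw [recoverSequential, if_pos ⟨h1, h2⟩]
    split_ifs with h4 h5
    · simp [h4]
    · rw [key t h5]
    · exact absurd (climbUp_eq_one [] (orderOf_dvd_iff_pow_eq_one.1 h3)) h5

end Recover

/-! ### The number of `z` with smooth `gcd (z, r)` -/

lemma dvd_powerProd_primesUpTo {X d : ℕ}
    (h : ∀ q, q.Prime → ¬ q ^ (Nat.log q X + 1) ∣ d) : d ∣ powerProd X (primesUpTo X) := by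
  rw [Nat.dvd_iff_prime_pow_dvd_dvd]
  intro q k hq hk
  have hle : k ≤ Nat.log q X := by
    by_contra! hlt
    exact h q hq ((pow_dvd_pow q hlt).trans hk)
  refine (pow_dvd_pow q hle).trans ?_
  -- Primes above X are absent from the list, but their logarithm is 0, so only their zeroth power
  -- is required.
  rcases Nat.eq_zero_or_pos (Nat.log q X) with h0 | h0
  · rw [h0, pow_zero]; exact one_dvd _
  · refine List.dvd_prod (List.mem_map.2 ⟨q, ?_, rfl⟩)
    have := (Nat.log_pos_iff.1 h0).1
    simp only [primesUpTo, List.mem_filter, List.mem_range, decide_eq_true_eq]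
    exact ⟨by omega, hq⟩

lemma card_filter_dvd_range_le {r d : ℕ} (hd : d ∣ r) :
    ((Finset.range r).filter (d ∣ ·)).card ≤ r / d := by
  have : (Finset.range r).filter (d ∣ ·) ⊆ (Finset.range (r / d)).image (d * ·) := by
    intro z hz
    simp only [Finset.mem_filter, Finset.mem_range, Finset.mem_image] at hz ⊢
    obtain ⟨hz, a, rfl⟩ := hz
    exact ⟨a, by rwa [Nat.lt_div_iff_mul_lt' hd], rfl⟩
  calc _ ≤ _ := Finset.card_le_card this
    _ ≤ _ := Finset.card_image_le
    _ = _ := Finset.card_range _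

/-- The first power of q above ⌊x⌋ is an integer, hence at least ⌊x⌋ + 1 > x. -/
lemma lt_pow_log_floor_succ {q : ℕ} (hq : q.Prime) (x : ℝ) :
    x < (q ^ (Nat.log q ⌊x⌋₊ + 1) : ℕ) :=
  (Nat.lt_floor_add_one x).trans_le
    (by exact_mod_cast Nat.lt_pow_succ_log_self hq.one_lt ⌊x⌋₊)

/-- The number of primes `q` for which `r` is divisible by a power of `q` exceeding `x`. -/
lemma card_mul_logb_le {r m : ℕ} (hr : 0 < r) (hrm : r < 2 ^ m) {x : ℝ} (hx : 1 ≤ x)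
    {Q : Finset ℕ} (hQ : ∀ q ∈ Q, q.Prime ∧ q ^ (Nat.log q ⌊x⌋₊ + 1) ∣ r) :
    (Q.card : ℝ) * Real.logb 2 x ≤ m := by
  have h1 : ∏ q ∈ Q, q ^ (Nat.log q ⌊x⌋₊ + 1) ∣ r :=
    Finset.prod_dvd_of_isRelPrime (fun p hp q hq hpq => Nat.coprime_iff_isRelPrime.1
      (Nat.Coprime.pow _ _ ((Nat.coprime_primes (hQ p hp).1 (hQ q hq).1).2 hpq)))
      fun q hq => (hQ q hq).2
  -- The prime powers are pairwise coprime divisors of r, each exceeding x, so their product lies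
  -- between x ^ Q.card and r.
  have h2 : x ^ Q.card ≤ 2 ^ m := by
    calc x ^ Q.card = ∏ q ∈ Q, x := by rw [Finset.prod_const]
      _ ≤ ∏ q ∈ Q, ((q ^ (Nat.log q ⌊x⌋₊ + 1) : ℕ) : ℝ) :=
        Finset.prod_le_prod (fun _ _ => by linarith) fun q hq =>
          (lt_pow_log_floor_succ (hQ q hq).1 x).le
      _ ≤ r := by rw [← Nat.cast_prod]; exact_mod_cast Nat.le_of_dvd hr h1
      _ ≤ 2 ^ m := by exact_mod_cast hrm.le
  have h3 := Real.logb_le_logb_of_le (b := 2) (by norm_num) (by positivity) h2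
  rwa [Real.logb_pow, Real.logb_pow, Real.logb_self_eq_one (by norm_num), mul_one] at h3

/-- Union bound over the primes in Q: each accounts for at most r / (c m) bad z, and there are at
most m / log(c m) such primes. -/
theorem le_card_smooth {r m : ℕ} (hr : 0 < r) (hrm : r < 2 ^ m) (hm : 2 ≤ m) {c : ℝ}
    (hc : 1 ≤ c) :
    (r : ℝ) * (1 - 1 / (c * Real.logb 2 (c * m))) ≤
      ((Finset.range r).filter fun z =>
        Nat.gcd r z ∣ powerProd ⌊c * m⌋₊ (primesUpTo ⌊c * m⌋₊)).card := by
  have hm' : (2 : ℝ) ≤ m := by exact_mod_cast hm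
  have hx : 2 ≤ c * m := by nlinarith
  have hlog : 0 < Real.logb 2 (c * m) := Real.logb_pos (by norm_num) (by linarith)
  set x := c * m with hxdef
  set X := ⌊x⌋₊
  have hr' : (0 : ℝ) < r := by exact_mod_cast hr
  set Q := r.primeFactors.filter fun q => q ^ (Nat.log q X + 1) ∣ r with hQdef
  have hQ : ∀ q ∈ Q, q.Prime ∧ q ^ (Nat.log q X + 1) ∣ r := fun q hq =>
    ⟨Nat.prime_of_mem_primeFactors (Finset.mem_filter.1 hq).1, (Finset.mem_filter.1 hq).2⟩
  have hcard := card_mul_logb_le hr hrm (by linarith) hQ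
  have hbad : (((Finset.range r).filter fun z =>
      ¬ Nat.gcd r z ∣ powerProd X (primesUpTo X)).card : ℝ) ≤ Q.card * (r / x) := by
    have hsub : ((Finset.range r).filter fun z =>
        ¬ Nat.gcd r z ∣ powerProd X (primesUpTo X)) ⊆
        Q.biUnion fun q => (Finset.range r).filter (q ^ (Nat.log q X + 1) ∣ ·) := by
      intro z hz
      obtain ⟨hz1, hz2⟩ := Finset.mem_filter.1 hz
      have := mt dvd_powerProd_primesUpTo hz2
      push Not at this
      obtain ⟨q, hq, hqd⟩ := this
      have hqr := hqd.trans (Nat.gcd_dvd_left r z)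
      refine Finset.mem_biUnion.2 ⟨q, Finset.mem_filter.2 ⟨?_, hqr⟩,
        Finset.mem_filter.2 ⟨hz1, hqd.trans (Nat.gcd_dvd_right r z)⟩⟩
      exact Nat.mem_primeFactors.2
        ⟨hq, (dvd_pow_self q (Nat.succ_ne_zero _)).trans hqr, hr.ne'⟩
    refine (Nat.cast_le.2 ((Finset.card_le_card hsub).trans Finset.card_biUnion_le)).trans ?_
    rw [Nat.cast_sum, ← nsmul_eq_mul, ← Finset.sum_const]
    refine Finset.sum_le_sum fun q hq => ?_
    refine (Nat.cast_le.2 (card_filter_dvd_range_le (hQ q hq).2)).trans ?_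
    refine Nat.cast_div_le.trans ?_
    exact div_le_div_of_nonneg_left hr'.le (by linarith) (lt_pow_log_floor_succ (hQ q hq).1 x).le
  have hsum : (((Finset.range r).filter fun z =>
      Nat.gcd r z ∣ powerProd X (primesUpTo X)).card : ℝ) + ((Finset.range r).filter fun z =>
      ¬ Nat.gcd r z ∣ powerProd X (primesUpTo X)).card = r := by
    have := Finset.card_filter_add_card_filter_not (s := Finset.range r)
      fun z => Nat.gcd r z ∣ powerProd X (primesUpTo X)
    rw [Finset.card_range] at this
    exact_mod_cast this
  have hfin : Q.card * (r / x) ≤ r * (1 / (c * Real.logb 2 x)) := by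
    rw [mul_div_assoc', mul_one_div, div_le_div_iff₀ (by linarith) (by positivity)]
    calc Q.card * r * (c * Real.logb 2 x) = r * c * (Q.card * Real.logb 2 x) := by ring
      _ ≤ r * c * m := by gcongr
      _ = r * x := by rw [hxdef]; ring
  linarith

open Real (sinc)

/-! ### A truncated partial fraction expansion of `1 / sin²` -/

/-- This is tan y ≥ y, squared in the form y² (1 - sin² y) ≤ sin² y and divided by y² sin² y. -/
lemma inv_sin_sq_le {y : ℝ} (h0 : 0 < |y|) (h1 : |y| ≤ Real.pi / 2) :
    1 / Real.sin y ^ 2 ≤ 1 / y ^ 2 + 1 := by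
  have key : ∀ y : ℝ, 0 < y → y ≤ Real.pi / 2 → y ^ 2 * Real.cos y ^ 2 ≤ Real.sin y ^ 2 := by
    intro y hy hy2
    have hs : 0 < Real.sin y := Real.sin_pos_of_pos_of_lt_pi hy (by linarith [Real.pi_pos])
    have hc : 0 ≤ Real.cos y := Real.cos_nonneg_of_neg_pi_div_two_le_of_le (by linarith) hy2
    have : y * Real.cos y ≤ Real.sin y := by
      rcases hc.eq_or_lt with h | h
      · rw [← h]; linarith
      · have := (Real.lt_tan hy (lt_of_le_of_ne hy2 fun h' => by
          rw [h', Real.cos_pi_div_two] at h; exact lt_irrefl _ h)).le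
        rwa [Real.tan_eq_sin_div_cos, le_div_iff₀ h] at this
    rw [← mul_pow]
    exact pow_le_pow_left₀ (by positivity) this 2
  have h2 := key |y| h0 h1
  rw [Real.cos_abs, sq_abs] at h2
  have h3 : Real.sin |y| ^ 2 = Real.sin y ^ 2 := by
    rcases abs_choice y with h | h <;> rw [h]
    rw [Real.sin_neg, neg_sq]
  have h4 : 0 < Real.sin y ^ 2 := by
    rw [← h3]
    exact pow_pos (Real.sin_pos_of_pos_of_lt_pi h0 (by linarith [Real.pi_pos])) 2
  rw [h3] at h2
  have hy : 0 < y ^ 2 := by rw [← sq_abs]; positivity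
  rw [div_add_one hy.ne', div_le_div_iff₀ h4 hy]
  nlinarith [Real.sin_sq_add_cos_sq y]

lemma inv_sin_sq_half {u : ℝ} (h : Real.sin u ≠ 0) :
    1 / Real.sin u ^ 2 =
      1 / 4 * (1 / Real.sin (u / 2) ^ 2 + 1 / Real.sin (u / 2 + Real.pi / 2) ^ 2) := by
  have h2 : Real.sin u = 2 * Real.sin (u / 2) * Real.cos (u / 2) := by
    rw [← Real.sin_two_mul]; ring_nf
  rw [Real.sin_add_pi_div_two, h2]
  have hs : Real.sin (u / 2) ≠ 0 := fun h' => h (by rw [h2, h']; ring)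
  have hc : Real.cos (u / 2) ≠ 0 := fun h' => h (by rw [h2, h']; ring)
  field_simp
  linarith [Real.sin_sq_add_cos_sq (u / 2)]

/-- The half-angle identity iterated n times: each point splits into two, whose indices differ by 2
^ n. -/
lemma inv_sin_sq_eq_sum {x : ℝ} (hx : Real.sin x ≠ 0) (n : ℕ) :
    1 / Real.sin x ^ 2 =
      1 / 4 ^ n * ∑ k ∈ Finset.range (2 ^ n), 1 / Real.sin ((x + k * Real.pi) / 2 ^ n) ^ 2 := by
  induction n with
  | zero => simp
  | succ n ih =>
    have hstep : ∀ k : ℕ, 1 / Real.sin ((x + k * Real.pi) / 2 ^ n) ^ 2 =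
        1 / 4 * (1 / Real.sin ((x + k * Real.pi) / 2 ^ (n + 1)) ^ 2 +
          1 / Real.sin ((x + (2 ^ n + k : ℕ) * Real.pi) / 2 ^ (n + 1)) ^ 2) := by
      intro k
      have e1 : (x + k * Real.pi) / 2 ^ (n + 1) = (x + k * Real.pi) / 2 ^ n / 2 := by
        rw [pow_succ, div_div]
      have e2 : (x + (2 ^ n + k : ℕ) * Real.pi) / 2 ^ (n + 1) =
          (x + k * Real.pi) / 2 ^ n / 2 + Real.pi / 2 := by
        push_cast; rw [pow_succ]; field_simp; ring
      rw [e1, e2, inv_sin_sq_half]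
      · intro h0
        obtain ⟨i, hi⟩ := Real.sin_eq_zero_iff.1 h0
        rw [eq_div_iff (by positivity)] at hi
        refine hx (Real.sin_eq_zero_iff.2 ⟨i * 2 ^ n - k, ?_⟩)
        push_cast
        linarith
    rw [ih, Finset.sum_congr rfl fun k _ => hstep k, ← Finset.mul_sum, Finset.sum_add_distrib,
      show (2 : ℕ) ^ (n + 1) = 2 ^ n + 2 ^ n by ring, Finset.sum_range_add, ← mul_assoc,
      div_mul_div_comm, one_mul, ← pow_succ]

lemma sum_Icc_succ (F : ℤ → ℝ) (K : ℕ) :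
    ∑ k ∈ Finset.Icc (-((K + 1 : ℕ) : ℤ)) ((K + 1 : ℕ) : ℤ), F k =
      ∑ k ∈ Finset.Icc (-(K : ℤ)) K, F k + F (K + 1) + F (-(K + 1)) := by
  have : Finset.Icc (-((K + 1 : ℕ) : ℤ)) ((K + 1 : ℕ) : ℤ) =
      insert (-(K + 1) : ℤ) (insert (K + 1 : ℤ) (Finset.Icc (-(K : ℤ)) K)) := by
    ext k; simp only [Finset.mem_Icc, Finset.mem_insert]; omega
  rw [this, Finset.sum_insert, Finset.sum_insert]
  · ring
  · simp
  · simp only [Finset.mem_insert, Finset.mem_Icc]; omega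

/-- Since |φ| ≤ 1/2, both new terms satisfy (φ ± (K + 1))² ≥ (K + 1/2)² ≥ K(K + 1), so they are at
most 1/K - 1/(K + 1) and the tail telescopes. -/
lemma sum_inv_sq_le {φ : ℝ} (hφ : |φ| ≤ 1 / 2) {B K : ℕ} (hB : 1 ≤ B) (hK : B ≤ K) :
    ∑ k ∈ Finset.Icc (-(K : ℤ)) K, 1 / (φ + (k : ℝ)) ^ 2 ≤
      ∑ k ∈ Finset.Icc (-(B : ℤ)) B, 1 / (φ + (k : ℝ)) ^ 2 + (2 / (B : ℝ) - 2 / (K : ℝ)) := by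
  induction K, hK using Nat.le_induction with
  | base => simp
  | succ K hK ih =>
    rw [sum_Icc_succ]
    rw [abs_le] at hφ
    have hK0 : (1 : ℝ) ≤ K := by exact_mod_cast hB.trans hK
    have bd : ∀ y : ℝ, (K : ℝ) * (K + 1) ≤ y ^ 2 → 1 / y ^ 2 ≤ 1 / K - 1 / (K + 1) := by
      intro y hy
      rw [div_sub_div _ _ (by positivity) (by positivity)]
      simp only [one_mul, mul_one, add_sub_cancel_left]
      exact one_div_le_one_div_of_le (by positivity) hy
    have h1 := bd (φ + (K + 1 : ℤ)) (by push_cast; nlinarith)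
    have h2 := bd (φ + (-(K + 1) : ℤ)) (by push_cast; nlinarith)
    push_cast at h1 h2 ⊢
    have e : ∀ z : ℝ, 2 / z = 1 / z + 1 / z := fun z => by ring
    rw [e (K + 1)]
    rw [e K] at ih
    linarith

/-- The finite identity with 2^(n+1) points is bounded termwise by 1/sin² y ≤ 1/y² + 1. The added
ones total 2^(n+1) / 4^(n+1) and vanish in the limit. -/
lemma inv_sin_sq_le_sum_add {φ : ℝ} (h0 : 0 < φ) (h1 : φ ≤ 1 / 2) {B : ℕ} (hB : 1 ≤ B) (n : ℕ)
    (hn : B ≤ 2 ^ n) :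
    Real.pi ^ 2 / Real.sin (Real.pi * φ) ^ 2 ≤
      ∑ k ∈ Finset.Icc (-(B : ℤ)) B, 1 / (φ + (k : ℝ)) ^ 2 + 2 / (B : ℝ) + Real.pi ^ 2 * (1 / 2) ^ n := by
  have hpi := Real.pi_pos
  have hs : Real.sin (Real.pi * φ) ≠ 0 :=
    (Real.sin_pos_of_pos_of_lt_pi (by positivity) (by nlinarith)).ne'
  -- The shift by 2 ^ n periods centres the sample points, so that all of them lie in [-π/2, π/2]
  -- after scaling.
  have hx : Real.sin (Real.pi * φ - (2 ^ n : ℕ) * Real.pi) ^ 2 = Real.sin (Real.pi * φ) ^ 2 := by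
    rw [Real.sin_sub_nat_mul_pi, mul_pow, ← pow_mul, mul_comm _ 2, pow_mul]; simp
  have hs' : Real.sin (Real.pi * φ - (2 ^ n : ℕ) * Real.pi) ≠ 0 := fun h =>
    hs (by rw [h] at hx; simpa using hx.symm)
  have hsum : 1 / Real.sin (Real.pi * φ) ^ 2 ≤ ∑ k ∈ Finset.range (2 ^ (n + 1)),
      (1 / Real.pi ^ 2 * (1 / (φ + ((k : ℤ) - 2 ^ n : ℤ)) ^ 2) + 1 / 4 ^ (n + 1)) := by
    rw [← hx, inv_sin_sq_eq_sum hs' (n + 1), Finset.mul_sum]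
    refine Finset.sum_le_sum fun k hk => ?_
    have hk' : (k : ℝ) + 1 ≤ 2 ^ n + 2 ^ n := by
      have : k + 1 ≤ 2 ^ n + 2 ^ n := by
        rw [Finset.mem_range, pow_succ] at hk; omega
      exact_mod_cast this
    have hk0 : (0 : ℝ) ≤ k := by positivity
    have hP : (0 : ℝ) < 2 ^ n := by positivity
    have hP2 : (2 : ℝ) ^ (n + 1) = 2 ^ n + 2 ^ n := by ring
    have hne : φ + ((k : ℝ) - 2 ^ n) ≠ 0 := by
      intro h
      have h2 : ((k : ℤ) - 2 ^ n : ℤ) = (-φ : ℝ) := by push_cast; linarith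
      have h3 : ((k : ℤ) - 2 ^ n : ℤ) < 0 := by exact_mod_cast (by rw [h2]; linarith :
        (((k : ℤ) - 2 ^ n : ℤ) : ℝ) < 0)
      have h4 : (-1 : ℤ) < ((k : ℤ) - 2 ^ n : ℤ) := by exact_mod_cast (by rw [h2]; linarith :
        (-1 : ℝ) < (((k : ℤ) - 2 ^ n : ℤ) : ℝ))
      omega
    have hy : (Real.pi * φ - (2 ^ n : ℕ) * Real.pi + k * Real.pi) / 2 ^ (n + 1) =
        Real.pi * (φ + ((k : ℝ) - 2 ^ n)) / 2 ^ (n + 1) := by push_cast; ring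
    rw [hy]
    have hle := inv_sin_sq_le (y := Real.pi * (φ + ((k : ℝ) - 2 ^ n)) / 2 ^ (n + 1))
      (abs_pos.2 (by positivity)) (by
        rw [abs_div, abs_mul, abs_of_pos hpi, abs_of_pos (by positivity : (0 : ℝ) < 2 ^ (n + 1)),
          div_le_iff₀ (by positivity), hP2]
        have : |φ + ((k : ℝ) - 2 ^ n)| ≤ 2 ^ n := by rw [abs_le]; constructor <;> linarith
        nlinarith)
    calc _ ≤ 1 / 4 ^ (n + 1) * (1 / (Real.pi * (φ + ((k : ℝ) - 2 ^ n)) / 2 ^ (n + 1)) ^ 2 + 1) :=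
          mul_le_mul_of_nonneg_left hle (by positivity)
      _ = _ := by
        have : (4 : ℝ) ^ (n + 1) = (2 ^ (n + 1)) ^ 2 := by
          rw [← pow_mul, mul_comm, pow_mul]; norm_num
        push_cast
        rw [this]
        field_simp
  rw [Finset.sum_add_distrib, ← Finset.mul_sum, Finset.sum_const, Finset.card_range,
    nsmul_eq_mul] at hsum
  have hinj : ∑ k ∈ Finset.range (2 ^ (n + 1)), 1 / (φ + ((k : ℤ) - 2 ^ n : ℤ)) ^ 2 ≤
      ∑ k ∈ Finset.Icc (-((2 ^ n : ℕ) : ℤ)) (2 ^ n : ℕ), 1 / (φ + (k : ℝ)) ^ 2 := by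
    rw [← Finset.sum_image (f := fun k : ℤ => 1 / (φ + (k : ℝ)) ^ 2)
      (g := fun k : ℕ => ((k : ℤ) - 2 ^ n : ℤ)) (fun a _ b _ h => by simpa using h)]
    refine Finset.sum_le_sum_of_subset_of_nonneg ?_ fun _ _ _ => by positivity
    intro k hk
    simp only [Finset.mem_image, Finset.mem_range, Finset.mem_Icc] at hk ⊢
    obtain ⟨a, ha, rfl⟩ := hk
    rw [pow_succ] at ha
    zify at ha
    push_cast
    constructor <;> omega
  have htail := sum_inv_sq_le (φ := φ) (abs_le.2 ⟨by linarith, h1⟩) hB hn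
  have h2K : (0 : ℝ) ≤ 2 / ((2 ^ n : ℕ) : ℝ) := by positivity
  have h3 : (((2 ^ (n + 1) : ℕ) : ℝ) * (1 / 4 ^ (n + 1))) ≤ (1 / 2) ^ n := by
    have : (4 : ℝ) ^ (n + 1) = 2 ^ (n + 1) * 2 ^ (n + 1) := by rw [← mul_pow]; norm_num
    rw [this, one_div_pow, Nat.cast_pow, Nat.cast_ofNat, mul_one_div, div_le_div_iff₀
      (by positivity) (by positivity), pow_succ]
    have hP : (0 : ℝ) < 2 ^ n := by positivity
    nlinarith
  calc Real.pi ^ 2 / Real.sin (Real.pi * φ) ^ 2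
      = Real.pi ^ 2 * (1 / Real.sin (Real.pi * φ) ^ 2) := by ring
    _ ≤ Real.pi ^ 2 * _ := mul_le_mul_of_nonneg_left hsum (by positivity)
    _ = ∑ k ∈ Finset.range (2 ^ (n + 1)), 1 / (φ + ((k : ℤ) - 2 ^ n : ℤ)) ^ 2 +
        Real.pi ^ 2 * (((2 ^ (n + 1) : ℕ) : ℝ) * (1 / 4 ^ (n + 1))) := by
      field_simp
    _ ≤ _ := by
      have := mul_le_mul_of_nonneg_left h3 (sq_nonneg Real.pi)
      linarith

lemma inv_sin_sq_le_sum_of_pos {φ : ℝ} (h0 : 0 < φ) (h1 : φ ≤ 1 / 2) {B : ℕ} (hB : 1 ≤ B) :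
    Real.pi ^ 2 / Real.sin (Real.pi * φ) ^ 2 ≤
      ∑ k ∈ Finset.Icc (-(B : ℤ)) B, 1 / (φ + (k : ℝ)) ^ 2 + 2 / (B : ℝ) := by
  have hlim : Filter.Tendsto (fun n : ℕ => ∑ k ∈ Finset.Icc (-(B : ℤ)) B, 1 / (φ + (k : ℝ)) ^ 2 + 2 / (B : ℝ) +
      Real.pi ^ 2 * (1 / 2 : ℝ) ^ n) Filter.atTop
      (nhds (∑ k ∈ Finset.Icc (-(B : ℤ)) B, 1 / (φ + (k : ℝ)) ^ 2 + 2 / (B : ℝ) + Real.pi ^ 2 * 0)) :=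
    tendsto_const_nhds.add ((tendsto_pow_atTop_nhds_zero_of_lt_one (by norm_num)
      (by norm_num)).const_mul _)
  rw [mul_zero, add_zero] at hlim
  refine ge_of_tendsto hlim ?_
  filter_upwards [Filter.eventually_ge_atTop B] with n hn
  exact inv_sin_sq_le_sum_add h0 h1 hB n (hn.trans Nat.lt_two_pow_self.le)

lemma inv_sin_sq_le_sum {φ : ℝ} (h0 : φ ≠ 0) (h1 : |φ| ≤ 1 / 2) {B : ℕ} (hB : 1 ≤ B) :
    Real.pi ^ 2 / Real.sin (Real.pi * φ) ^ 2 ≤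
      ∑ k ∈ Finset.Icc (-(B : ℤ)) B, 1 / (φ + (k : ℝ)) ^ 2 + 2 / (B : ℝ) := by
  rcases h0.lt_or_gt with h | h
  · have := inv_sin_sq_le_sum_of_pos (neg_pos.2 h) (by rw [abs_of_neg h] at h1; exact h1) hB
    rw [mul_neg, Real.sin_neg, neg_sq] at this
    refine this.trans_eq ?_
    congr 1
    refine Finset.sum_nbij' (fun k => -k) (fun k => -k) ?_ ?_ ?_ ?_ ?_
    · intro k hk; simp only [Finset.mem_Icc] at hk ⊢; omega
    · intro k hk; simp only [Finset.mem_Icc] at hk ⊢; omega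
    · simp
    · simp
    · intro k _; rw [← neg_sq]; push_cast; ring_nf
  · exact inv_sin_sq_le_sum_of_pos h ((le_abs_self φ).trans h1) hB

/-- All but a fraction `2 / (π² B)` of the mass of `sinc²` on a translate of `π ℤ` is carried by
the `2 B + 1` points closest to zero. -/
theorem le_sum_sinc_sq {φ : ℝ} (h1 : |φ| ≤ 1 / 2) {B : ℕ} (hB : 1 ≤ B) :
    1 - 1 / Real.pi ^ 2 * (2 / (B : ℝ)) ≤
      ∑ k ∈ Finset.Icc (-(B : ℤ)) B, sinc (Real.pi * (φ + k)) ^ 2 := by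
  have hpi := Real.pi_pos
  have hpos : (0 : ℝ) ≤ 1 / Real.pi ^ 2 * (2 / (B : ℝ)) := by positivity
  -- At φ = 0 the bound on 1/sin² is unavailable, but the term k = 0 alone equals 1.
  rcases eq_or_ne φ 0 with rfl | h0
  · have : sinc (Real.pi * (0 + ((0 : ℤ) : ℝ))) ^ 2 = 1 := by simp
    refine le_trans (by rw [this]; linarith) (Finset.single_le_sum
      (f := fun k : ℤ => sinc (Real.pi * (0 + (k : ℝ))) ^ 2) (fun _ _ => sq_nonneg _)
      (by simp : (0 : ℤ) ∈ Finset.Icc (-(B : ℤ)) B))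
  have hs : 0 < Real.sin (Real.pi * φ) ^ 2 := by
    refine pow_pos ?_ 2 |>.trans_eq (sq_abs _)
    refine abs_pos.2 fun h => ?_
    obtain ⟨i, hi⟩ := Real.sin_eq_zero_iff.1 h
    have hi' : (i : ℝ) = φ := mul_right_cancel₀ hpi.ne' (by rw [hi]; ring)
    rw [← hi'] at h1 h0
    have h2 : |(i : ℝ)| < 1 := by linarith
    have h3 : |i| < 1 := by exact_mod_cast h2
    exact h0 (by rw [Int.abs_lt_one_iff.1 h3]; simp)
  have hterm : ∀ k : ℤ, sinc (Real.pi * (φ + k)) ^ 2 =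
      Real.sin (Real.pi * φ) ^ 2 / Real.pi ^ 2 * (1 / (φ + (k : ℝ)) ^ 2) := by
    intro k
    have hk : φ + k ≠ 0 := by
      intro h
      have : φ = ((-k : ℤ) : ℝ) := by push_cast; linarith
      rw [this, mul_comm, Real.sin_int_mul_pi] at hs
      simp at hs
    rw [Real.sinc_of_ne_zero (by positivity), mul_add, mul_comm Real.pi (k : ℝ),
      Real.sin_add_int_mul_pi, div_pow, mul_pow, ← sq_abs ((-1 : ℝ) ^ k), abs_zpow, abs_neg,
      abs_one, one_zpow, one_pow, one_mul, mul_comm (k : ℝ), ← mul_add, mul_pow]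
    field_simp
  rw [Finset.sum_congr rfl fun k _ => hterm k, ← Finset.mul_sum]
  have hmain := inv_sin_sq_le_sum h0 h1 hB
  have hs1 : Real.sin (Real.pi * φ) ^ 2 ≤ 1 := Real.sin_sq_le_one _
  have hB0 : (0 : ℝ) ≤ 2 / (B : ℝ) := by positivity
  set S := ∑ k ∈ Finset.Icc (-(B : ℤ)) B, 1 / (φ + (k : ℝ)) ^ 2
  have h2 : Real.pi ^ 2 ≤ Real.sin (Real.pi * φ) ^ 2 * (S + 2 / (B : ℝ)) := by
    rw [div_le_iff₀ hs] at hmain; linarith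
  -- The tail 2/B carries the factor sin², which is at most 1.
  have h3 : Real.pi ^ 2 - 2 / (B : ℝ) ≤ Real.sin (Real.pi * φ) ^ 2 * S := by nlinarith
  calc 1 - 1 / Real.pi ^ 2 * (2 / (B : ℝ)) = (Real.pi ^ 2 - 2 / (B : ℝ)) / Real.pi ^ 2 := by field_simp
    _ ≤ Real.sin (Real.pi * φ) ^ 2 * S / Real.pi ^ 2 := by gcongr
    _ = _ := by ring

/-! ### The distribution of the observed frequency -/

section Distribution

/-- The difference factors as sin(a - b) sin(a + b), and |sin t| ≤ |t|. -/
lemma abs_sin_sq_sub_sin_sq_le (a b : ℝ) :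
    |Real.sin a ^ 2 - Real.sin b ^ 2| ≤ |a ^ 2 - b ^ 2| := by
  have h : Real.sin a ^ 2 - Real.sin b ^ 2 = Real.sin (a - b) * Real.sin (a + b) := by
    rw [Real.sin_sub, Real.sin_add]
    nlinarith [Real.sin_sq_add_cos_sq a, Real.sin_sq_add_cos_sq b]
  have h2 : a ^ 2 - b ^ 2 = (a - b) * (a + b) := by ring
  rw [h, h2, abs_mul, abs_mul]
  exact mul_le_mul Real.abs_sin_le_abs Real.abs_sin_le_abs (abs_nonneg _) (abs_nonneg _)

/-- The closed form of the geometric sum, with |sin x| ≤ |x| in the denominator; the product form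
also covers the zeros of sin x. -/
lemma sin_sq_le_norm_sum_exp_sq_mul (x : ℝ) (L : ℕ) :
    Real.sin (L * x) ^ 2 ≤
      ‖∑ b ∈ Finset.range L, Complex.exp (Complex.I * (2 * x : ℝ)) ^ b‖ ^ 2 * x ^ 2 := by
  have h := congrArg norm (geom_sum_mul (Complex.exp (Complex.I * (2 * x : ℝ))) L)
  have h2 : Complex.exp (Complex.I * (2 * x : ℝ)) ^ L =
      Complex.exp (Complex.I * (2 * (L * x) : ℝ)) := by
    rw [← Complex.exp_nat_mul]; congr 1; push_cast; ring
  rw [norm_mul, h2, Complex.norm_exp_I_mul_ofReal_sub_one,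
    Complex.norm_exp_I_mul_ofReal_sub_one] at h
  simp only [mul_div_cancel_left₀ _ (two_ne_zero' ℝ), norm_mul, Real.norm_eq_abs] at h
  set S := ‖∑ b ∈ Finset.range L, Complex.exp (Complex.I * (2 * x : ℝ)) ^ b‖
  have h3 : S * |Real.sin x| = |Real.sin (L * x)| := by
    rw [abs_of_pos (two_pos : (0 : ℝ) < 2)] at h; linarith
  rw [← sq_abs (Real.sin _), ← h3, mul_pow, ← sq_abs x]
  exact mul_le_mul_of_nonneg_left (pow_le_pow_left₀ (abs_nonneg _) Real.abs_sin_le_abs 2)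
    (sq_nonneg _)

/-- A geometric sum of about `u` terms compared with its continuous analogue. -/
lemma le_norm_sum_exp_sq {u : ℝ} (hu : 1 ≤ u) {L : ℕ} (hL : |(L : ℝ) - u| ≤ 1) (x : ℝ) :
    u ^ 2 * sinc (u * x) ^ 2 - 3 * u ≤
      ‖∑ b ∈ Finset.range L, Complex.exp (Complex.I * (2 * x : ℝ)) ^ b‖ ^ 2 := by
  -- The factors |L - u| ≤ 1 and L + u ≤ 2u + 1 ≤ 3u give the constant 3.
  have hLu : |(L : ℝ) ^ 2 - u ^ 2| ≤ 3 * u := by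
    rw [show (L : ℝ) ^ 2 - u ^ 2 = (L - u) * (L + u) by ring, abs_mul,
      abs_of_nonneg (by positivity : (0 : ℝ) ≤ L + u)]
    have := (abs_le.1 hL).2
    nlinarith [abs_nonneg ((L : ℝ) - u)]
  rcases eq_or_ne x 0 with rfl | hx
  · have := (abs_le.1 hLu).1
    simp
    linarith
  have h1 := sin_sq_le_norm_sum_exp_sq_mul x L
  have h2 := (abs_le.1 (abs_sin_sq_sub_sin_sq_le (L * x) (u * x))).1
  rw [mul_pow, mul_pow, ← sub_mul, abs_mul, abs_of_nonneg (sq_nonneg x)] at h2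
  have hx2 : 0 < x ^ 2 := by positivity
  refine le_of_mul_le_mul_right (le_trans ?_ h1) hx2
  rw [Real.sinc_of_ne_zero (by positivity)]
  have h3 : u ^ 2 * (Real.sin (u * x) / (u * x)) ^ 2 * x ^ 2 = Real.sin (u * x) ^ 2 := by
    field_simp
  rw [sub_mul, h3]
  nlinarith

variable {G : Type*} [Group G] [DecidableEq G]

lemma quantumState_apply (g : G) (n : ℕ) (j : Fin (2 ^ n)) (h : G) :
    quantumState g n (j, h) = (1 / (2 : ℂ) ^ n) * ∑ a ∈ (Finset.range (2 ^ n)).filter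
      (fun a => g ^ a = h), Complex.exp (2 * (Real.pi : ℂ) * Complex.I / (2 : ℂ) ^ n * (a : ℂ) *
        ((j : ℕ) : ℂ)) := by
  rw [Finset.sum_filter, ← Fin.sum_univ_eq_sum_range (fun a => if g ^ a = h then
    Complex.exp (2 * (Real.pi : ℂ) * Complex.I / (2 : ℂ) ^ n * (a : ℂ) * ((j : ℕ) : ℂ)) else 0)]
  simp only [quantumState, PiLp.smul_apply, smul_eq_mul]
  congr 1
  simp only [WithLp.ofLp_sum, Finset.sum_apply, PiLp.smul_apply, smul_eq_mul]
  refine Finset.sum_congr rfl fun a _ => ?_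
  rw [Finset.sum_eq_single j]
  · simp [eq_comm]
  · intro b _ hb
    simp [hb.symm]
  · simp

variable [Fintype G]

/-- The exponents below `N` that are congruent to `e` modulo `r`. -/
lemma filter_pow_eq_image (g : G) {N e : ℕ} (he : e < orderOf g) :
    (Finset.range N).filter (fun a => g ^ a = g ^ e) =
      (Finset.range ((N + orderOf g - 1 - e) / orderOf g)).image fun b => e + orderOf g * b := by
  have hr : 0 < orderOf g := orderOf_pos g
  ext a
  simp only [Finset.mem_filter, Finset.mem_range, Finset.mem_image, pow_eq_pow_iff_modEq,
    Nat.lt_iff_add_one_le, Nat.le_div_iff_mul_le hr]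
  constructor
  · rintro ⟨ha, hmod⟩
    have h1 : a % orderOf g = e := by rw [hmod, Nat.mod_eq_of_lt he]
    have h2 := Nat.mod_add_div a (orderOf g)
    rw [h1] at h2
    refine ⟨a / orderOf g, ?_, h2⟩
    rw [add_mul, one_mul, mul_comm]
    omega
  · rintro ⟨b, hb, rfl⟩
    rw [add_mul, one_mul, mul_comm] at hb
    refine ⟨by omega, ?_⟩
    simp [Nat.ModEq]

/-- The quotient is ⌈(N - e) / r⌉, the number of exponents in one residue class. -/
lemma abs_card_sub_le {N e r : ℕ} (he : e < r) :
    |(((N + r - 1 - e) / r : ℕ) : ℝ) - (N : ℝ) / r| ≤ 1 := by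
  have hr : 0 < r := by omega
  have hr' : (0 : ℝ) < r := by exact_mod_cast hr
  set L := (N + r - 1 - e) / r
  have h1 : r * L ≤ N + r - 1 - e := Nat.mul_div_le _ _
  have h2 : N + r - 1 - e < r * (L + 1) := Nat.lt_mul_div_succ _ hr
  have h1' : (r : ℝ) * L ≤ N + r := by exact_mod_cast (by omega : r * L ≤ N + r)
  have h2' : (N : ℝ) ≤ r * (L + 1) := by exact_mod_cast (by omega : N ≤ r * (L + 1))
  rw [abs_le]
  constructor
  · rw [le_sub_iff_add_le, ← sub_eq_neg_add, sub_le_iff_le_add, div_le_iff₀ hr']; linarith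
  · rw [sub_le_iff_le_add, ← sub_le_iff_le_add', le_div_iff₀ hr']; linarith

lemma norm_quantumState_sq_ge (g : G) {n : ℕ} (hn : orderOf g ≤ 2 ^ n) (j : Fin (2 ^ n)) (z : ℤ)
    {e : ℕ} (he : e < orderOf g) :
    1 / (orderOf g : ℝ) ^ 2 *
        sinc (Real.pi * ((j : ℕ) - (2 : ℝ) ^ n * z / orderOf g)) ^ 2 -
        3 / ((2 : ℝ) ^ n * orderOf g) ≤
      ‖quantumState g n (j, g ^ e)‖ ^ 2 := by
  have hr : 0 < orderOf g := orderOf_pos g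
  rw [quantumState_apply, filter_pow_eq_image g he, Finset.sum_image fun a _ b _ h =>
    Nat.eq_of_mul_eq_mul_left hr (Nat.add_left_cancel h)]
  set r := orderOf g
  set L := (2 ^ n + r - 1 - e) / r
  have hr' : (0 : ℝ) < r := by exact_mod_cast hr
  set x : ℝ := Real.pi * (r * (j : ℕ) / 2 ^ n - z) with hx
  have hterm : ∀ b : ℕ, Complex.exp (2 * (Real.pi : ℂ) * Complex.I / (2 : ℂ) ^ n *
      ((e + r * b : ℕ) : ℂ) * ((j : ℕ) : ℂ)) =
      Complex.exp ((2 * Real.pi * e * (j : ℕ) / 2 ^ n : ℝ) * Complex.I) *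
        Complex.exp (Complex.I * (2 * x : ℝ)) ^ b := by
    intro b
    rw [← Complex.exp_nat_mul, ← Complex.exp_add, Complex.exp_eq_exp_iff_exists_int]
    -- Subtracting z from r j / 2^n changes the phase of the b-th term by z b full turns.
    refine ⟨z * b, ?_⟩
    rw [hx]
    push_cast
    field_simp
    ring
  rw [Finset.sum_congr rfl fun b _ => hterm b, ← Finset.mul_sum, norm_mul, norm_mul,
    Complex.norm_exp_ofReal_mul_I, one_mul, mul_pow]
  have hu : (1 : ℝ) ≤ 2 ^ n / r := by
    rw [one_le_div hr']; exact_mod_cast hn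
  have hmain := le_norm_sum_exp_sq hu (L := L)
    (by have := abs_card_sub_le (N := 2 ^ n) he; push_cast at this; exact this) x
  have hux : (2 : ℝ) ^ n / r * x = Real.pi * ((j : ℕ) - (2 : ℝ) ^ n * z / r) := by
    rw [hx]; field_simp
  rw [hux] at hmain
  have hnorm : ‖(1 : ℂ) / 2 ^ n‖ ^ 2 = 1 / ((2 : ℝ) ^ n) ^ 2 := by
    simp
  rw [hnorm]
  refine le_trans (le_of_eq ?_) (mul_le_mul_of_nonneg_left hmain (by positivity))
  field_simp

/-- Each of the r elements g ^ e contributes the same lower bound. Leaving z an arbitrary integer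
allows for reduction of j modulo 2 ^ n. -/
theorem frequencyProb_ge (g : G) {n : ℕ} (hn : orderOf g ≤ 2 ^ n) (j : Fin (2 ^ n)) (z : ℤ) :
    1 / (orderOf g : ℝ) * sinc (Real.pi * ((j : ℕ) - (2 : ℝ) ^ n * z / orderOf g)) ^ 2 -
        3 / (2 : ℝ) ^ n ≤ frequencyProb g n j := by
  have hr : (0 : ℝ) < orderOf g := by exact_mod_cast orderOf_pos g
  calc _ = ∑ e ∈ Finset.range (orderOf g), (1 / (orderOf g : ℝ) ^ 2 *
        sinc (Real.pi * ((j : ℕ) - (2 : ℝ) ^ n * z / orderOf g)) ^ 2 -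
        3 / ((2 : ℝ) ^ n * orderOf g)) := by
        rw [Finset.sum_const, Finset.card_range, nsmul_eq_mul]
        field_simp
    _ ≤ ∑ e ∈ Finset.range (orderOf g), ‖quantumState g n (j, g ^ e)‖ ^ 2 :=
        Finset.sum_le_sum fun e he => norm_quantumState_sq_ge g hn j z (Finset.mem_range.1 he)
    _ = ∑ h ∈ (Finset.range (orderOf g)).image (g ^ ·), ‖quantumState g n (j, h)‖ ^ 2 := by
        rw [Finset.sum_image]
        intro a ha b hb hab
        exact pow_injOn_Iio_orderOf (by simpa using ha) (by simpa using hb) hab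
    _ ≤ _ := Finset.sum_le_sum_of_subset_of_nonneg (Finset.subset_univ _)
        fun _ _ _ => sq_nonneg _

lemma frequencyProb_nonneg (g : G) (n : ℕ) (j : Fin (2 ^ n)) : 0 ≤ frequencyProb g n j :=
  Finset.sum_nonneg fun _ _ => sq_nonneg _

end Distribution

/-! ### The success probability -/

/-- The integer nearest to `2 ^ n * z / r`. -/
noncomputable def peak (n r z : ℕ) : ℤ := round ((2 : ℝ) ^ n * z / r)

/-- The frequency at offset `t` from the `z`-th peak. -/
noncomputable def nearPeak (n r z : ℕ) (t : ℤ) : Fin (2 ^ n) :=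
  ⟨((peak n r z + t) % 2 ^ n).toNat, by
    have h := Int.emod_lt_of_pos (peak n r z + t) (by positivity : (0 : ℤ) < 2 ^ n)
    have h0 := Int.emod_nonneg (peak n r z + t) (by positivity : (2 : ℤ) ^ n ≠ 0)
    zify
    rwa [Int.toNat_of_nonneg h0]⟩

lemma nearPeak_coe (n r z : ℕ) (t : ℤ) :
    (((nearPeak n r z t : Fin (2 ^ n)) : ℕ) : ℤ) = (peak n r z + t) % 2 ^ n :=
  Int.toNat_of_nonneg (Int.emod_nonneg _ (by positivity))

lemma abs_peak_sub_le (n r z : ℕ) : |(peak n r z : ℝ) - (2 : ℝ) ^ n * z / r| ≤ 1 / 2 := by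
  rw [abs_sub_comm]; exact abs_sub_round _

lemma card_candidateFrequencies_le (n B : ℕ) (j : Fin (2 ^ n)) :
    (candidateFrequencies n B j).card ≤ 2 * B + 1 := by
  refine Finset.card_image_le.trans ?_
  rw [Int.card_Icc]; omega

lemma peak_mem_candidateFrequencies (n r z : ℕ) {B : ℕ} {t : ℤ}
    (ht : t ∈ Finset.Icc (-(B : ℤ)) B) :
    peak n r z % 2 ^ n ∈ candidateFrequencies n B (nearPeak n r z t) := by
  rw [candidateFrequencies, Finset.mem_image]
  refine ⟨-t, by rw [Finset.mem_Icc] at ht ⊢; omega, ?_⟩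
  rw [nearPeak_coe, Int.emod_add_emod, add_neg_cancel_right]

/-- With x = r/d and y = z/d, rounding gives |x * peak - y 2^n| ≤ x/2, so `dot` of the stored vector
with itself is at most 2x² < 2^(2m+1). -/
lemma div_gcd_mem_frequencyCandidates {m n r z : ℕ} (hr : 0 < r) (hrm : r < 2 ^ m) :
    r / Nat.gcd r z ∈ frequencyCandidates m n (peak n r z % 2 ^ n) := by
  have hd : 0 < Nat.gcd r z := Nat.gcd_pos_of_pos_left _ hr
  obtain ⟨x, hx⟩ := Nat.gcd_dvd_left r z
  obtain ⟨y, hy⟩ := Nat.gcd_dvd_right r z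
  set d := Nat.gcd r z with hdd
  have hxd : r / d = x := by rw [hx]; exact Nat.mul_div_cancel_left _ hd
  have hyd : z / d = y := by rw [hy]; exact Nat.mul_div_cancel_left _ hd
  have hco : Nat.Coprime x y := by
    rw [← hxd, ← hyd]; exact Nat.coprime_div_gcd_div_gcd hd
  -- Reducing the peak modulo 2 ^ n alters the second coefficient by a multiple of x, which
  -- preserves coprimality.
  have hco' : IsCoprime (x : ℤ) (x * (peak n r z / 2 ^ n) - y) := by
    have h1 := (Nat.isCoprime_iff_coprime.2 hco).neg_right
    have h2 := (IsCoprime.add_mul_left_right h1 (peak n r z / 2 ^ n))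
    rwa [neg_add_eq_sub] at h2
  have hmod := Int.emod_add_mul_ediv (peak n r z) (2 ^ n)
  have hval : (x : ℤ) * (peak n r z % 2 ^ n) + (x * (peak n r z / 2 ^ n) - y) * 2 ^ n =
      x * peak n r z - y * 2 ^ n := by
    conv_rhs => rw [← hmod]
    ring
  have hxr : x ≤ r := by rw [← hxd]; exact Nat.div_le_self _ _
  have hbound : 4 * ((x : ℤ) * peak n r z - y * 2 ^ n) ^ 2 ≤ (x : ℤ) ^ 2 := by
    have h := abs_peak_sub_le n r z
    have hd' : (0 : ℝ) < d := by exact_mod_cast hd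
    have hx0 : (0 : ℝ) < x := by
      have : 0 < x := Nat.pos_of_ne_zero fun h0 => by rw [h0] at hx; omega
      exact_mod_cast this
    have hq : (2 : ℝ) ^ n * z / r = (2 : ℝ) ^ n * y / x := by
      rw [hx, hy]; push_cast; field_simp
    rw [hq] at h
    have h2 : ((x : ℝ) * peak n r z - y * 2 ^ n) = x * (peak n r z - (2 : ℝ) ^ n * y / x) := by
      field_simp
    have h3 : 4 * ((x : ℝ) * peak n r z - y * 2 ^ n) ^ 2 ≤ (x : ℝ) ^ 2 := by
      have h4 := sq_le_sq' (abs_le.1 h).1 (abs_le.1 h).2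
      rw [h2, mul_pow]
      nlinarith [sq_nonneg (x : ℝ)]
    exact_mod_cast h3
  have h := natAbs_mem_frequencyCandidates (m := m) (n := n) hco' (by
    rw [hval]
    have h1 : (x : ℤ) < 2 ^ m := by exact_mod_cast hxr.trans_lt hrm
    have h2 : (x : ℤ) ^ 2 < (2 ^ m) ^ 2 := pow_lt_pow_left₀ h1 (by positivity) two_ne_zero
    rw [← pow_mul] at h2
    rw [_root_.pow_succ (2 : ℤ) (2 * m), mul_comm 2 m]
    linarith)
  rwa [Int.natAbs_natCast, ← hxd] at h

/-- A collision modulo 2^n makes (2^n / r) |z' - z - r s| at most 2B + 1, from two offsets and two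
roundings. This is below 2^n / r, so the integer vanishes, and |z' - z| < r forces s = 0. -/
lemma nearPeak_injOn {n r B : ℕ} (hr : 0 < r) (hB : 2 * (B : ℝ) + 1 < (2 : ℝ) ^ n / r) :
    Set.InjOn (fun p : ℕ × ℤ => nearPeak n r p.1 p.2)
      (Finset.range r ×ˢ Finset.Icc (-(B : ℤ)) B : Finset (ℕ × ℤ)) := by
  rintro ⟨z, t⟩ hp ⟨z', t'⟩ hp' heq
  simp only [Finset.coe_product, Set.mem_prod, Finset.coe_range, Set.mem_Iio, Finset.coe_Icc,
    Set.mem_Icc] at hp hp'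
  obtain ⟨hz, ht1, ht2⟩ := hp
  obtain ⟨hz', ht1', ht2'⟩ := hp'
  have h1 : (peak n r z + t) % 2 ^ n = (peak n r z' + t') % 2 ^ n := by
    rw [← nearPeak_coe, ← nearPeak_coe]
    exact congrArg (fun j : Fin (2 ^ n) => ((j : ℕ) : ℤ)) heq
  obtain ⟨s, hs⟩ := Int.ModEq.dvd h1
  have hr' : (0 : ℝ) < r := by exact_mod_cast hr
  have hu : (0 : ℝ) < (2 : ℝ) ^ n / r := by positivity
  have hs' : (peak n r z' : ℝ) + t' - (peak n r z + t) = 2 ^ n * s := by exact_mod_cast hs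
  have hval : (2 : ℝ) ^ n / r * ((z' : ℝ) - z - r * s) =
      ((peak n r z : ℝ) - 2 ^ n * z / r) - (peak n r z' - 2 ^ n * z' / r) + (t - t') := by
    have : (2 : ℝ) ^ n / r * ((z' : ℝ) - z - r * s) =
      2 ^ n * z' / r - 2 ^ n * z / r - 2 ^ n * s := by field_simp
    rw [this, ← hs']; ring
  obtain ⟨a1, a2⟩ := abs_le.1 (abs_peak_sub_le n r z)
  obtain ⟨b1, b2⟩ := abs_le.1 (abs_peak_sub_le n r z')
  have c1 : -(B : ℝ) ≤ t := by exact_mod_cast ht1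
  have c2 : (t : ℝ) ≤ B := by exact_mod_cast ht2
  have d1 : -(B : ℝ) ≤ t' := by exact_mod_cast ht1'
  have d2 : (t' : ℝ) ≤ B := by exact_mod_cast ht2'
  have hlt : (2 : ℝ) ^ n / r * |(z' : ℝ) - z - r * s| < (2 : ℝ) ^ n / r * 1 := by
    rw [← abs_of_pos hu, ← abs_mul, abs_of_pos hu, hval, abs_lt]
    constructor <;> linarith
  have h2 : |(z' : ℤ) - z - r * s| < 1 := by exact_mod_cast lt_of_mul_lt_mul_left hlt hu.le
  have h3 := Int.abs_lt_one_iff.1 h2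
  have h4 : (z' : ℤ) - z = 0 := Int.eq_zero_of_abs_lt_dvd (m := r) ⟨s, by linarith⟩
    (by rw [abs_lt]; omega)
  have h5 : s = 0 := by
    have : (r : ℤ) * s = 0 := by linarith
    exact (mul_eq_zero.1 this).resolve_left (by omega)
  obtain rfl : z = z' := by omega
  rw [h5] at hs
  simp only [Prod.mk.injEq, true_and]
  linarith

/-- The candidate r/d recovers r because g ^ (r/d) has order d. No smaller value occurs, since t
times the order of g ^ t is a positive multiple of r. -/
theorem classicalOutput_nearPeak {G : Type*} [Group G] [Fintype G] [DecidableEq G] {g : G}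
    {X m n B z : ℕ} {t : ℤ} {recover : ℕ → Option ℕ} (hrec : RecoverSpec g X m recover)
    (hrm : orderOf g < 2 ^ m) (ht : t ∈ Finset.Icc (-(B : ℤ)) B)
    (hsmooth : Nat.gcd (orderOf g) z ∣ powerProd X (primesUpTo X)) :
    classicalOutput recover m n B (nearPeak n (orderOf g) z t) = (orderOf g : WithTop ℕ) := by
  have hr : 0 < orderOf g := orderOf_pos g
  have hdvd := Nat.gcd_dvd_left (orderOf g) z
  set d := Nat.gcd (orderOf g) z with hd
  have hd0 : 0 < d := Nat.gcd_pos_of_pos_left _ hr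
  have hdiv : 0 < orderOf g / d := Nat.div_pos (Nat.le_of_dvd hr hdvd) hd0
  have hord : orderOf (g ^ (orderOf g / d)) = d := by
    rw [orderOf_pow_of_dvd hdiv.ne' (Nat.div_dvd_of_dvd hdvd), Nat.div_div_self hdvd hr.ne']
  have hsome : recover (orderOf g / d) = some (orderOf g) := by
    rw [hrec.of_dvd _ hdiv ((Nat.div_le_self _ _).trans_lt hrm) (by rwa [hord]), hord,
      Nat.mul_div_cancel' hdvd]
  apply le_antisymm
  · refine Finset.min_le (Finset.mem_biUnion.2 ⟨_, peak_mem_candidateFrequencies _ _ _ ht,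
      Finset.mem_biUnion.2 ⟨_, div_gcd_mem_frequencyCandidates hr hrm, ?_⟩⟩)
    rw [← hd, hsome]; simp
  · refine Finset.le_min fun v hv => ?_
    simp only [Finset.mem_biUnion, Option.mem_toFinset, Option.mem_def] at hv
    obtain ⟨-, -, t', -, hv⟩ := hv
    obtain ⟨ht', rfl⟩ := hrec.eq_of_mem t' v hv
    have hle : orderOf g ≤ orderOf (g ^ t') * t' := by
      refine Nat.le_of_dvd (Nat.mul_pos (orderOf_pos (g ^ t')) ht') ?_
      rw [orderOf_dvd_iff_pow_eq_one, mul_comm, pow_mul, pow_orderOf_eq_one]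
    exact WithTop.coe_le_coe.2 hle

/-- Each peak contributes nearly `1 / r` to the probability. -/
lemma le_sum_frequencyProb_nearPeak {G : Type*} [Group G] [Fintype G] [DecidableEq G] (g : G)
    {n B : ℕ} (hn : orderOf g ≤ 2 ^ n) (hB : 1 ≤ B) (z : ℕ) :
    1 / (orderOf g : ℝ) * (1 - 1 / Real.pi ^ 2 * (2 / B)) - (2 * B + 1) * (3 / (2 : ℝ) ^ n) ≤
      ∑ t ∈ Finset.Icc (-(B : ℤ)) B, frequencyProb g n (nearPeak n (orderOf g) z t) := by
  have hr : (0 : ℝ) < orderOf g := by exact_mod_cast orderOf_pos g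
  have hterm : ∀ t : ℤ, 1 / (orderOf g : ℝ) * sinc (Real.pi *
      (((peak n (orderOf g) z : ℝ) - (2 : ℝ) ^ n * z / orderOf g) + t)) ^ 2 - 3 / (2 : ℝ) ^ n ≤
      frequencyProb g n (nearPeak n (orderOf g) z t) := by
    intro t
    -- Reduction modulo 2 ^ n subtracts 2 ^ n q from the frequency; replacing z by z - q r
    -- compensates for it.
    set q := (peak n (orderOf g) z + t) / 2 ^ n
    refine le_trans (le_of_eq ?_) (frequencyProb_ge g hn (nearPeak n (orderOf g) z t)
      (z - q * orderOf g))
    have h1 : ((nearPeak n (orderOf g) z t : Fin (2 ^ n)) : ℤ) =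
        peak n (orderOf g) z + t - 2 ^ n * q := by
      rw [nearPeak_coe, Int.emod_def]
    have h2 : (((nearPeak n (orderOf g) z t : Fin (2 ^ n)) : ℕ) : ℝ) =
        peak n (orderOf g) z + t - 2 ^ n * q := by exact_mod_cast h1
    rw [h2]
    congr 5
    push_cast
    field_simp
    ring
  refine le_trans ?_ (Finset.sum_le_sum fun t _ => hterm t)
  rw [Finset.sum_sub_distrib, ← Finset.mul_sum, Finset.sum_const, nsmul_eq_mul, Int.card_Icc]
  have hc : ((((B : ℤ) + 1 - -(B : ℤ)).toNat : ℕ) : ℝ) = 2 * B + 1 := by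
    rw [show ((B : ℤ) + 1 - -(B : ℤ)).toNat = 2 * B + 1 by omega]; push_cast; ring
  rw [hc]
  gcongr
  exact le_sum_sinc_sq (abs_peak_sub_le n (orderOf g) z) hB

lemma successProb_nonneg {G : Type*} [Group G] [Fintype G] [DecidableEq G] (g : G)
    (recover : ℕ → Option ℕ) (m n B : ℕ) : 0 ≤ successProb g recover m n B :=
  Finset.sum_nonneg fun j _ => frequencyProb_nonneg g n j

theorem le_successProb {G : Type*} [Group G] [Fintype G] [DecidableEq G] {g : G} {m n B : ℕ}
    (hr : 2 ≤ orderOf g) (hrm : orderOf g < 2 ^ m) {c : ℝ} (hc : 1 ≤ c) (hB : 1 ≤ B)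
    (hBmax : 2 * (B : ℝ) + 1 < (2 : ℝ) ^ n / orderOf g) {recover : ℕ → Option ℕ}
    (hrec : RecoverSpec g ⌊c * m⌋₊ m recover) :
    (1 - 1 / Real.pi ^ 2 * (2 / (B : ℝ) + 1 / (B : ℝ) ^ 2 + 1 / (3 * (B : ℝ) ^ 3))
        - Real.pi ^ 2 * (orderOf g : ℝ) * (2 * (B : ℝ) + 1) / (2 : ℝ) ^ n)
      * (1 - 1 / (c * Real.logb 2 (c * m))) ≤ successProb g recover m n B := by
  have hr0 : 0 < orderOf g := by omega
  have hr' : (0 : ℝ) < orderOf g := by exact_mod_cast hr0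
  have hm : 2 ≤ m := by
    by_contra! h
    have : 2 ^ m ≤ 2 ^ 1 := Nat.pow_le_pow_right (by norm_num) (by omega)
    omega
  have hm' : (2 : ℝ) ≤ m := by exact_mod_cast hm
  have hn : orderOf g ≤ 2 ^ n := by
    rw [lt_div_iff₀ hr'] at hBmax
    have : (orderOf g : ℝ) ≤ 2 ^ n := by nlinarith [(Nat.cast_nonneg B : (0 : ℝ) ≤ B)]
    exact_mod_cast this
  set E := 1 - 1 / Real.pi ^ 2 * (2 / (B : ℝ) + 1 / (B : ℝ) ^ 2 + 1 / (3 * (B : ℝ) ^ 3))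
        - Real.pi ^ 2 * (orderOf g : ℝ) * (2 * (B : ℝ) + 1) / (2 : ℝ) ^ n with hE
  have hlog : 1 ≤ Real.logb 2 (c * m) := by
    rw [Real.le_logb_iff_rpow_le (by norm_num) (by positivity), Real.rpow_one]; nlinarith
  have hfac : 0 ≤ 1 - 1 / (c * Real.logb 2 (c * m)) := by
    rw [sub_nonneg, div_le_one (by positivity)]; nlinarith
  -- If E is not positive the bound is trivial; otherwise E / r may multiply the lower bound for the
  -- number of good z.
  rcases le_total E 0 with hneg | hpos
  · exact (mul_nonpos_of_nonpos_of_nonneg hneg hfac).trans (successProb_nonneg _ _ _ _ _)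
  set Z := (Finset.range (orderOf g)).filter fun z =>
    Nat.gcd (orderOf g) z ∣ powerProd ⌊c * m⌋₊ (primesUpTo ⌊c * m⌋₊) with hZ
  have hcard : (orderOf g : ℝ) * (1 - 1 / (c * Real.logb 2 (c * m))) ≤ Z.card :=
    le_card_smooth hr0 hrm hm hc
  have hpeak : ∀ z : ℕ, E / orderOf g ≤
      ∑ t ∈ Finset.Icc (-(B : ℤ)) B, frequencyProb g n (nearPeak n (orderOf g) z t) := by
    intro z
    refine le_trans ?_ (le_sum_frequencyProb_nearPeak g hn hB z)
    have hpi : (3 : ℝ) ≤ Real.pi ^ 2 := by nlinarith [Real.pi_gt_three]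
    have h1 : (3 : ℝ) * orderOf g * (2 * B + 1) / 2 ^ n ≤
        Real.pi ^ 2 * orderOf g * (2 * B + 1) / 2 ^ n := by gcongr
    have h2 : 1 / Real.pi ^ 2 * (2 / (B : ℝ)) ≤
        1 / Real.pi ^ 2 * (2 / (B : ℝ) + 1 / (B : ℝ) ^ 2 + 1 / (3 * (B : ℝ) ^ 3)) := by
      refine mul_le_mul_of_nonneg_left ?_ (by positivity)
      have : (0 : ℝ) ≤ 1 / (B : ℝ) ^ 2 + 1 / (3 * (B : ℝ) ^ 3) := by positivity
      linarith
    rw [div_le_iff₀ hr']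
    calc E ≤ 1 - 1 / Real.pi ^ 2 * (2 / (B : ℝ)) -
          3 * orderOf g * (2 * B + 1) / 2 ^ n := by rw [hE]; linarith
      _ = _ := by field_simp
  calc E * (1 - 1 / (c * Real.logb 2 (c * m)))
      = (orderOf g * (1 - 1 / (c * Real.logb 2 (c * m)))) * (E / orderOf g) := by field_simp
    _ ≤ Z.card * (E / orderOf g) :=
        mul_le_mul_of_nonneg_right hcard (div_nonneg hpos hr'.le)
    _ = ∑ z ∈ Z, E / orderOf g := by rw [Finset.sum_const, nsmul_eq_mul]
    _ ≤ ∑ z ∈ Z, ∑ t ∈ Finset.Icc (-(B : ℤ)) B,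
          frequencyProb g n (nearPeak n (orderOf g) z t) := Finset.sum_le_sum fun z _ => hpeak z
    _ = ∑ p ∈ Z ×ˢ Finset.Icc (-(B : ℤ)) B,
          frequencyProb g n (nearPeak n (orderOf g) p.1 p.2) := by rw [Finset.sum_product]
    _ = ∑ j ∈ (Z ×ˢ Finset.Icc (-(B : ℤ)) B).image fun p => nearPeak n (orderOf g) p.1 p.2,
          frequencyProb g n j := by
        rw [Finset.sum_image]
        refine (nearPeak_injOn hr0 hBmax).mono ?_
        exact Finset.coe_subset.2 (Finset.product_subset_product_left (Finset.filter_subset _ _))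
    _ ≤ successProb g recover m n B := by
        refine Finset.sum_le_sum_of_subset_of_nonneg ?_ fun j _ _ => frequencyProb_nonneg g n j
        intro j hj
        obtain ⟨⟨z, t⟩, hp, rfl⟩ := Finset.mem_image.1 hj
        obtain ⟨hz, ht⟩ := Finset.mem_product.1 hp
        exact Finset.mem_filter.2 ⟨Finset.mem_univ _,
          classicalOutput_nearPeak hrec hrm ht (Finset.mem_filter.1 hz).2⟩

end OrderFinding

theorem mainTheorem4 {G : Type*} [Group G] [Fintype G] [DecidableEq G] (g : G) (r : ℕ)
    (hgr : orderOf g = r) (hr : 2 ≤ r)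
    (m ℓ Δ : ℕ) (hm : 0 < m) (hrm : r < 2 ^ m) (hΔ : Δ < m) (hℓ : ℓ = m - Δ)
    (c : ℝ) (hc : 1 ≤ c)
    (B : ℕ) (hB : 1 ≤ B) (hBmax : (B : ℝ) < ((2 : ℝ) ^ (m + ℓ) / (r : ℝ) - 1) / 2) :
    (∀ j : Fin (2 ^ (m + ℓ)),
      (OrderFinding.candidateFrequencies (m + ℓ) B j).card ≤ 2 * B + 1 ∧
      ∀ k ∈ OrderFinding.candidateFrequencies (m + ℓ) B j,
        (∀ w ∈ OrderFinding.enumeratedVectors m (m + ℓ) k,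
          OrderFinding.toVec w ∈ OrderFinding.lattice (m + ℓ) k) ∧
        ((OrderFinding.enumeratedVectors m (m + ℓ) k).card : ℝ) ≤
          6 * Real.sqrt 3 * (2 : ℝ) ^ Δ) ∧
    (∀ recover ∈ [OrderFinding.recoverSequential g ⌊c * (m : ℝ)⌋₊ m,
        OrderFinding.recoverTree g ⌊c * (m : ℝ)⌋₊ m],
      (1 - 1 / Real.pi ^ 2 * (2 / (B : ℝ) + 1 / (B : ℝ) ^ 2 + 1 / (3 * (B : ℝ) ^ 3))
          - Real.pi ^ 2 * (r : ℝ) * (2 * (B : ℝ) + 1) / (2 : ℝ) ^ (m + ℓ))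
        * (1 - 1 / (c * Real.logb 2 (c * (m : ℝ))))
      ≤ OrderFinding.successProb g recover m (m + ℓ) B) := by
  refine ⟨fun j => ⟨OrderFinding.card_candidateFrequencies_le _ _ _, fun k _ =>
    ⟨fun w hw => OrderFinding.toVec_mem_lattice_of_mem_enumeratedVectors hw,
      OrderFinding.card_enumeratedVectors_le k (by omega)⟩⟩, fun recover hrec => ?_⟩
  subst hgr
  have hspec : OrderFinding.RecoverSpec g ⌊c * (m : ℝ)⌋₊ m recover := by
    simp only [List.mem_cons, List.not_mem_nil, or_false] at hrec
    rcases hrec with rfl | rfl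
    · exact OrderFinding.recoverSequential_spec g _ m
    · refine OrderFinding.recoverTree_spec g (Nat.le_floor ?_) m
      -- From 2 ≤ r < 2^m; hence c m ≥ 2 and the prime list of the tree contains 2.
      have hm2 : 2 ≤ m := by
        by_contra! h
        have : 2 ^ m ≤ 2 ^ 1 := Nat.pow_le_pow_right (by norm_num) (by omega)
        omega
      have hm' : (2 : ℝ) ≤ m := by exact_mod_cast hm2
      push_cast
      nlinarith
  exact OrderFinding.le_successProb hr hrm hc hB (by linarith) hspec
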